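/- **Singular Serre–Swan theorem.** Let $M$ be a smooth manifold (finite-dimensional, Hausdorff, second-countable). The functor $\Gamma$ of global smooth sections, $E\mapsto\Gamma(E)$, $f\mapsto f_*$ with $f_*(\sigma)=f\circ\sigma$, takes values in the full subcategory of $C^\infty(M)$-modules that are locally finitely generated, global and fiber-determined, and it is an equivalence of categories from the category of VB-tepui over $M$ to that full subcategory. Here the terms have the following meaning. *Diffeology.* All topologies on diffeological spaces are D-topologies (the final topology for the plots), and subsets, such as fibers, carry the subspace diffeology. A smooth map $\varphi\colon X\to Y$ of diffeological spaces is a *plotwise submersion* if for every $x\in X$ and every plot $p\colon (U,0)\to (Y,\varphi(x))$ there is a plot $q\colon (U',0)\to (X,x)$ with $\varphi\circ q=p$ as germs at $0$; it is a *local subduction* if it is moreover surjective. A *tepui fibration* is a local subduction $\varphi\colon X\to M$ from a second-countable diffeological space $X$ such that all fibers $X_m=\varphi^{-1}(m)$ are Hausdorff and second-countable, and for every $x\in X$ there is a plot $p\colon U\to X$, with $U$ open in some $\mathbb R^k$, that is a plotwise submersion, has $x$ in its image, and is injective on $(\varphi\circ p)^{-1}(\varphi(x))$. *VB-tepui.*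 A *diffeological bundle of vector spaces* over $M$ is a smooth map $E\to M$ of diffeological spaces whose fibers are real vector spaces such that the fiberwise addition $E\times_M E\to E$, the zero section $M\to E$ and the scalar multiplication $\mathbb R\times E\to E$ are smooth. It is a *VB-tepui* if $E\to M$ is a tepui fibration. Morphisms are the smooth, fiberwise linear maps over the identity of $M$. *Modules.* Let $C^\infty_M$ be the sheaf of smooth real functions on $M$ and let $Q$ be a $C^\infty(M)$-module. The localization $L(Q)$ is the sheaf of $C^\infty_M$-modules associated with the presheaf $U\mapsto S_U^{-1}Q$, where $S_U$ is the set of smooth functions on $M$ without zeros on $U$. The module $Q$ is * *locally finitely generated* if every point of $M$ has an open neighbourhood on which the sheaf $L(Q)$ is generated by finitely many sections; * *global* if $Q\cong\mathcal S(M)$ for some sheaf $\mathcal S$ of $C^\infty_M$-modules; * *fiber-determined* if $\bigcap_{m\in M} I_mQ=0$, where $I_m\subset C^\infty(M)$ is the ideal of functions vanishing at $m$. -/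

import Mathlib

open CategoryTheory Opposite TopologicalSpace Diffeology
open scoped Manifold ContDiff Topology

universe u

noncomputable section

namespace SerreSwan

/-! ### Diffeological spaces: subspaces, products, manifolds -/

/-- The pullback of a diffeology along a map `f : Y → X`: the plots are the maps which become
plots of `X` after composition with `f`. For injective `f` this is the subspace diffeology. -/
@[reducible] def inducedDiffeology {X Y : Type*} [DiffeologicalSpace X] (f : Y → X) :
    DiffeologicalSpace Y where
  plots _ := {p | IsPlot (f ∘ p)}
  constant_plots y := isPlot_const (x := f y)
  plot_reparam hp hf := isPlot_reparam (X := X) hp hf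
  locality {k p} hp := DiffeologicalSpace.locality (X := X) (p := f ∘ p) fun x ↦ by
    obtain ⟨u, hu, hxu, h⟩ := hp x
    exact ⟨u, hu, hxu, fun {m g} hg hg' ↦ h hg hg'⟩

/-- The subspace diffeology. -/
instance subtypeDiffeology {X : Type*} [DiffeologicalSpace X] (s : X → Prop) :
    DiffeologicalSpace (Subtype s) := inducedDiffeology Subtype.val

/-- The product diffeology. -/
instance prodDiffeology {X Y : Type*} [DiffeologicalSpace X] [DiffeologicalSpace Y] :
    DiffeologicalSpace (X × Y) where
  plots _ := {p | IsPlot (fun v ↦ (p v).1) ∧ IsPlot (fun v ↦ (p v).2)}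
  constant_plots z := ⟨isPlot_const, isPlot_const⟩
  plot_reparam hp hf := ⟨isPlot_reparam hp.1 hf, isPlot_reparam hp.2 hf⟩
  locality {k p} hp := by
    refine ⟨DiffeologicalSpace.locality fun x ↦ ?_, DiffeologicalSpace.locality fun x ↦ ?_⟩
    · obtain ⟨u, hu, hxu, h⟩ := hp x
      exact ⟨u, hu, hxu, fun {m g} hg hg' ↦ (h hg hg').1⟩
    · obtain ⟨u, hu, hxu, h⟩ := hp x
      exact ⟨u, hu, hxu, fun {m g} hg hg' ↦ (h hg hg').2⟩

/-- The diffeology of a smooth manifold: the plots are the smooth maps. -/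
@[reducible] def manifoldDiffeology (n : ℕ) (M : Type*) [TopologicalSpace M]
    [ChartedSpace (EuclideanSpace ℝ (Fin n)) M] : DiffeologicalSpace M where
  plots k := {p | ContMDiff (𝓡 k) (𝓡 n) ∞ p}
  constant_plots _ := contMDiff_const
  plot_reparam hp hf := ContMDiff.comp hp hf.contMDiff
  locality {k p} hp := by
    intro x
    obtain ⟨u, hu, hxu, h⟩ := hp x
    obtain ⟨ε, hε, hε'⟩ := Metric.isOpen_iff.mp hu x hxu
    let b := OpenPartialHomeomorph.univBall x ε
    have hb : ContMDiff (𝓡 k) (𝓡 n) ∞ (p ∘ b) := h (f := b) (fun y ↦ hε' (by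
      have hy := b.map_source (x := y) (by simp [b])
      rwa [OpenPartialHomeomorph.univBall_target x hε] at hy))
      OpenPartialHomeomorph.contDiff_univBall
    have hs : ContMDiffOn (𝓡 k) (𝓡 k) ∞ b.symm (Metric.ball x ε) :=
      (OpenPartialHomeomorph.contDiffOn_univBall_symm (c := x) (r := ε)).contMDiffOn
    have hx : Metric.ball x ε ∈ 𝓝 x := Metric.ball_mem_nhds x hε
    refine (((hb _).comp_contMDiffWithinAt x (hs x (mem_of_mem_nhds hx))).contMDiffAt
      hx).congr_of_eventuallyEq ?_
    filter_upwards [hx] with y hy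
    have : b (b.symm y) = y :=
      b.right_inv (by rwa [OpenPartialHomeomorph.univBall_target x hε])
    simp [this]

/-! ### Plotwise submersions and tepui fibrations -/

/-- A smooth map `φ : X → Y` is a plotwise submersion if for every point `x` each (germ at `0` of
a) plot of `Y` through `φ x` lifts to a germ of a plot through `x`. Every germ at `0` of a plot
defined on an open subset of a Euclidean space is the germ of a plot defined on the whole space, so
that it suffices to speak of the latter. -/
structure IsPlotwiseSubmersion {X Y : Type*} [DiffeologicalSpace X] [DiffeologicalSpace Y]
    (φ : X → Y) : Prop where
  dSmooth : DSmooth φ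
  exists_lift : ∀ (x : X) (k : ℕ) (p : EuclideanSpace ℝ (Fin k) → Y), IsPlot p → p 0 = φ x →
    ∃ q : EuclideanSpace ℝ (Fin k) → X, IsPlot q ∧ q 0 = x ∧ φ ∘ q =ᶠ[𝓝 0] p

/-- A local subduction is a surjective plotwise submersion. -/
structure IsLocalSubduction {X Y : Type*} [DiffeologicalSpace X] [DiffeologicalSpace Y]
    (φ : X → Y) : Prop extends IsPlotwiseSubmersion φ where
  surjective : Function.Surjective φ

/-- `p : U → X`, with `U` an open subset of a Euclidean space, is a minimal chart at `x` of
`φ : X → M`: it is a plotwise submersion (in particular it is smooth, that is, a plot), its image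
contains `x`, and it is injective on the fibre of `φ ∘ p` over `φ x`. -/
structure IsMinimalChart {X M : Type*} [DiffeologicalSpace X] (φ : X → M) (x : X) {k : ℕ}
    (U : Set (EuclideanSpace ℝ (Fin k))) (p : U → X) : Prop where
  isOpen : IsOpen U
  isPlotwiseSubmersion : IsPlotwiseSubmersion p
  mem_range : x ∈ Set.range p
  injOn : Set.InjOn p {v | φ (p v) = φ x}

/-- A tepui fibration: a local subduction with second-countable total space which admits a minimal
chart at each point and whose fibres, as diffeological subspaces, are Hausdorff and
second-countable. All topologies here are D-topologies. -/
structure IsTepuiFibration {X M : Type*} [DiffeologicalSpace X] [DiffeologicalSpace M]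
    (φ : X → M) : Prop where
  isLocalSubduction : IsLocalSubduction φ
  secondCountable : @SecondCountableTopology X dTopology
  exists_minimalChart : ∀ x : X, ∃ (k : ℕ) (U : Set (EuclideanSpace ℝ (Fin k))) (p : U → X),
    IsMinimalChart φ x U p
  t2_fiber : ∀ m : M, @T2Space {x : X // φ x = m} dTopology
  secondCountable_fiber : ∀ m : M, @SecondCountableTopology {x : X // φ x = m} dTopology

section Manifold

variable (n : ℕ) (M : Type u) [TopologicalSpace M] [ChartedSpace (EuclideanSpace ℝ (Fin n)) M]

/-- The ring `C^∞(M)` of smooth real functions on `M`. -/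
abbrev SmoothFunctions : Type u := C^∞⟮𝓡 n, M; 𝓘(ℝ, ℝ), ℝ⟯

/-! ### VB-tepui and their morphisms -/

/-- A diffeological bundle of vector spaces over the manifold `M`. The underlying set of its total
space is the disjoint union of its fibres, which are real vector spaces; the total space carries a
diffeology for which the projection, the zero section, the fibrewise addition (on the fibre product
of the total space with itself) and the scalar multiplication are smooth. -/
structure DiffVectorBundle where
  /-- the fibres -/
  Fiber : M → Type u
  [addCommGroup : ∀ m, AddCommGroup (Fiber m)]
  [module : ∀ m, Module ℝ (Fiber m)]
  /-- the diffeology of the total space -/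
  [diffeology : DiffeologicalSpace (Σ m, Fiber m)]
  dSmooth_proj :
    letI := manifoldDiffeology n M
    DSmooth (fun e : Σ m, Fiber m ↦ e.1)
  dSmooth_zero :
    letI := manifoldDiffeology n M
    DSmooth (fun m : M ↦ (⟨m, 0⟩ : Σ m, Fiber m))
  dSmooth_add :
    letI : DiffeologicalSpace (Σ m, Fiber m × Fiber m) := inducedDiffeology
      fun e ↦ ((⟨e.1, e.2.1⟩, ⟨e.1, e.2.2⟩) : (Σ m, Fiber m) × (Σ m, Fiber m))
    DSmooth (fun e : Σ m, Fiber m × Fiber m ↦ (⟨e.1, e.2.1 + e.2.2⟩ : Σ m, Fiber m))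
  dSmooth_smul :
    DSmooth (fun e : ℝ × (Σ m, Fiber m) ↦ (⟨e.2.1, e.1 • e.2.2⟩ : Σ m, Fiber m))

attribute [instance] DiffVectorBundle.addCommGroup DiffVectorBundle.module
  DiffVectorBundle.diffeology

variable {n M}

/-- The total space. -/
abbrev DiffVectorBundle.Total (E : DiffVectorBundle n M) : Type u := Σ m, E.Fiber m

variable (n M) in
/-- A VB-tepui over `M` is a diffeological bundle of vector spaces over `M` whose projection is a
tepui fibration. -/
structure VBTepui extends DiffVectorBundle n M where
  isTepuiFibration :
    letI := manifoldDiffeology n M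
    IsTepuiFibration (fun e : toDiffVectorBundle.Total ↦ e.1)

namespace VBTepui

/-- A morphism of VB-tepui over `M`: a smooth map of the total spaces over the identity of `M`
which is linear on the fibres. -/
@[ext] structure Hom (E E' : VBTepui n M) where
  /-- the linear maps between the fibres -/
  toFun : ∀ m, E.Fiber m →ₗ[ℝ] E'.Fiber m
  dSmooth : DSmooth (fun e : E.Total ↦ (⟨e.1, toFun e.1 e.2⟩ : E'.Total))

instance : Category (VBTepui n M) where
  Hom := Hom
  id E := ⟨fun _ ↦ LinearMap.id, dSmooth_id⟩
  comp f g := ⟨fun m ↦ g.toFun m ∘ₗ f.toFun m, g.dSmooth.comp f.dSmooth⟩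

/-! ### The section functor -/

/-- The smooth sections of a VB-tepui. -/
@[ext] structure Section (E : VBTepui n M) where
  /-- the value of a section at a point -/
  toFun : ∀ m, E.Fiber m
  dSmooth :
    letI := manifoldDiffeology n M
    DSmooth (fun m : M ↦ (⟨m, toFun m⟩ : E.Total))

namespace Section

variable {E : VBTepui n M}

theorem toFun_injective : Function.Injective (toFun : E.Section → ∀ m, E.Fiber m) :=
  fun _ _ h ↦ Section.ext h

instance : Zero E.Section := ⟨⟨0, E.dSmooth_zero⟩⟩

instance : Add E.Section where
  add s t := ⟨s.toFun + t.toFun, fun k p hp ↦ by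
    let _ : DiffeologicalSpace (Σ m, E.Fiber m × E.Fiber m) := inducedDiffeology
      fun e ↦ ((⟨e.1, e.2.1⟩, ⟨e.1, e.2.2⟩) : (Σ m, E.Fiber m) × (Σ m, E.Fiber m))
    exact E.dSmooth_add k (fun v ↦ ⟨p v, s.toFun (p v), t.toFun (p v)⟩)
      ⟨s.dSmooth k p hp, t.dSmooth k p hp⟩⟩

instance : SMul (SmoothFunctions n M) E.Section where
  smul f s := ⟨fun m ↦ f m • s.toFun m, fun k p hp ↦
    E.dSmooth_smul k (fun v ↦ (f (p v), ⟨p v, s.toFun (p v)⟩))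
      ⟨(f.contMDiff.comp hp).contDiff, s.dSmooth k p hp⟩⟩

instance : SMul ℝ E.Section where
  smul c s := ⟨fun m ↦ c • s.toFun m, fun k p hp ↦
    E.dSmooth_smul k (fun v ↦ (c, ⟨p v, s.toFun (p v)⟩)) ⟨isPlot_const, s.dSmooth k p hp⟩⟩

instance : Neg E.Section := ⟨fun s ↦ ⟨-s.toFun, by
  have h := ((-1 : ℝ) • s).dSmooth
  have e : ((-1 : ℝ) • s).toFun = -s.toFun := funext fun m ↦ neg_one_smul ℝ (s.toFun m)
  rwa [e] at h⟩⟩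

instance : AddCommGroup E.Section where
  add_assoc s t r := toFun_injective (add_assoc s.toFun t.toFun r.toFun)
  zero_add s := toFun_injective (zero_add s.toFun)
  add_zero s := toFun_injective (add_zero s.toFun)
  add_comm s t := toFun_injective (add_comm s.toFun t.toFun)
  neg_add_cancel s := toFun_injective (neg_add_cancel s.toFun)
  nsmul := nsmulRec
  zsmul := zsmulRec

/-- The pointwise `C^∞(M)`-module structure on the sections. -/
instance : Module (SmoothFunctions n M) E.Section where
  one_smul s := toFun_injective (funext fun m ↦ one_smul ℝ (s.toFun m))
  mul_smul f g s := toFun_injective (funext fun m ↦ mul_smul (f m) (g m) (s.toFun m))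
  smul_zero f := toFun_injective (funext fun m ↦ smul_zero (f m))
  smul_add f s t := toFun_injective (funext fun m ↦ smul_add (f m) (s.toFun m) (t.toFun m))
  add_smul f g s := toFun_injective (funext fun m ↦ add_smul (f m) (g m) (s.toFun m))
  zero_smul s := toFun_injective (funext fun m ↦ zero_smul ℝ (s.toFun m))

end Section

/-- The map `σ ↦ f ∘ σ` on sections. -/
def Hom.mapSection {E E' : VBTepui n M} (f : Hom E E') :
    E.Section →ₗ[SmoothFunctions n M] E'.Section where
  toFun s := ⟨fun m ↦ f.toFun m (s.toFun m), fun k p hp ↦ f.dSmooth k _ (s.dSmooth k p hp)⟩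
  map_add' s t := Section.ext (funext fun m ↦ map_add (f.toFun m) (s.toFun m) (t.toFun m))
  map_smul' c s := Section.ext (funext fun m ↦ map_smul (f.toFun m) (c m) (s.toFun m))

end VBTepui

variable (n M) in
/-- The global section functor from VB-tepui over `M` to `C^∞(M)`-modules. -/
def sectionFunctor : VBTepui n M ⥤ ModuleCat.{u} (SmoothFunctions n M) where
  obj E := ModuleCat.of _ E.Section
  map f := ModuleCat.ofHom (VBTepui.Hom.mapSection f)

/-! ### Fiber-determined modules -/

/-- The ideal of the smooth functions vanishing at `m`. -/
def vanishingIdeal (m : M) : Ideal (SmoothFunctions n M) :=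
  RingHom.ker (ContMDiffMap.evalRingHom m : SmoothFunctions n M →+* ℝ)

/-- An element `q` of a `C^∞(M)`-module `Q` is invisible if its class in `Q / I_m Q` vanishes for
all `m ∈ M`, where `I_m` is the ideal of the functions vanishing at `m`. -/
def IsInvisible {Q : ModuleCat.{u} (SmoothFunctions n M)} (q : Q) : Prop :=
  ∀ m : M, (Submodule.Quotient.mk q :
    Q ⧸ (vanishingIdeal (n := n) m • ⊤ : Submodule (SmoothFunctions n M) Q)) = 0

/-- A `C^∞(M)`-module is fiber-determined if its only invisible element is zero. -/
def IsFiberDetermined (Q : ModuleCat.{u} (SmoothFunctions n M)) : Prop :=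
  ∀ q : Q, IsInvisible q → q = 0

/-! ### The sheaf of smooth functions and global modules -/

variable (n M) in
/-- The local predicate `smooth` on real functions on open subsets of `M`. -/
def smoothPredicate : TopCat.LocalPredicate (X := TopCat.of M) fun _ ↦ ℝ where
  pred {U} f := ContMDiff (M := (U : Opens M)) (𝓡 n) 𝓘(ℝ, ℝ) ∞ f
  res {U V} i f hf := ContMDiff.comp hf (contMDiff_inclusion (leOfHom i))
  locality {V} f h x := by
    obtain ⟨U, hxU, i, hU⟩ := h x
    have hUV : (U : Opens M) ≤ V := leOfHom i
    exact ((contDiffWithinAt_localInvariantProp (I := 𝓡 n) (I' := 𝓘(ℝ, ℝ))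
      ∞).liftPropAt_iff_comp_inclusion hUV f ⟨x.1, hxU⟩).2 (hU ⟨x.1, hxU⟩)

variable (n M) in
/-- The sheaf of rings of smooth functions on `M`. -/
def smoothSheaf : Sheaf (Opens.grothendieckTopology M) RingCat.{u} where
  obj :=
    { obj := fun U ↦ RingCat.of (SmoothFunctions n (unop U : Opens M))
      map := fun i ↦ RingCat.ofHom
        (ContMDiffMap.restrictRingHom (𝓡 n) 𝓘(ℝ, ℝ) ℝ (leOfHom i.unop))
      map_id := fun _ ↦ rfl
      map_comp := fun _ _ ↦ rfl }
  property := by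
    rw [Presheaf.isSheaf_iff_isSheaf_forget _ _ (forget RingCat)]
    exact TopCat.subpresheafToTypes.isSheaf (smoothPredicate n M)

/-- The restriction of smooth functions from `M` to an open subset. -/
def restrict (U : Opens M) : SmoothFunctions n M →+* SmoothFunctions n U where
  toFun f := ⟨fun x ↦ f x, f.contMDiff.comp contMDiff_subtype_val⟩
  map_one' := rfl
  map_mul' _ _ := rfl
  map_zero' := rfl
  map_add' _ _ := rfl

variable (n M) in
/-- The global sections functor `G` from sheaves of modules over the sheaf of smooth functions to
`C^∞(M)`-modules. -/
def globalSections : SheafOfModules.{u} (smoothSheaf n M) ⥤ ModuleCat.{u} (SmoothFunctions n M) :=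
  SheafOfModules.evaluation (smoothSheaf n M) (op ⊤) ⋙ ModuleCat.restrictScalars (restrict ⊤)

/-- A `C^∞(M)`-module is global if it is in the essential image of `G`. -/
def IsGlobal (Q : ModuleCat.{u} (SmoothFunctions n M)) : Prop :=
  (globalSections n M).essImage Q

/-! ### Localization of modules and locally finitely generated modules -/

variable (n) in
/-- The multiplicative set `S_U` of the smooth functions on `M` without zeroes on `U`. -/
def nonvanishing (U : Opens M) : Submonoid (SmoothFunctions n M) where
  carrier := {f | ∀ x ∈ U, f x ≠ 0}
  one_mem' _ _ := one_ne_zero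
  mul_mem' hf hg x hx := mul_ne_zero (hf x hx) (hg x hx)

theorem nonvanishing_mono {U V : Opens M} (h : V ≤ U) : nonvanishing n U ≤ nonvanishing n V :=
  fun _ hf x hx ↦ hf x (h hx)

/-- The restriction map `S_U⁻¹ C^∞(M) → S_V⁻¹ C^∞(M)` for `V ⊆ U`. -/
def localizationMap {U V : Opens M} (h : V ≤ U) :
    Localization (nonvanishing n U) →+* Localization (nonvanishing n V) :=
  IsLocalization.map (M := nonvanishing n U) (T := nonvanishing n V)
    (Localization (nonvanishing n V)) (RingHom.id _)
    (show nonvanishing n U ≤ (nonvanishing n V).comap (RingHom.id _) from nonvanishing_mono h)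

theorem localizationMap_mk {U V : Opens M} (h : V ≤ U) (f : SmoothFunctions n M)
    (s : nonvanishing n U) : localizationMap h (Localization.mk f s) =
      Localization.mk f ⟨s.1, nonvanishing_mono h s.2⟩ := by
  rw [Localization.mk_eq_mk', Localization.mk_eq_mk']
  exact IsLocalization.map_mk' _ f s

variable (n M) in
/-- The presheaf of rings `U ↦ S_U⁻¹ C^∞(M)`. -/
def localizationPresheaf : (Opens M)ᵒᵖ ⥤ RingCat.{u} where
  obj U := RingCat.of (Localization (nonvanishing n (unop U)))
  map i := RingCat.ofHom (localizationMap (leOfHom i.unop))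
  map_id U := by
    ext x
    induction x using Localization.induction_on with | _ p
    exact localizationMap_mk (le_refl (unop U)) p.1 p.2
  map_comp i j := by
    ext x
    induction x using Localization.induction_on with | _ p
    exact (localizationMap_mk (leOfHom (i ≫ j).unop) p.1 p.2).trans
      ((congrArg (localizationMap (leOfHom j.unop))
        (localizationMap_mk (leOfHom i.unop) p.1 p.2)).trans
        (localizationMap_mk (leOfHom j.unop) p.1 _)).symm

theorem isUnit_restrict {U : Opens M} (s : nonvanishing n U) :
    IsUnit (restrict U (s : SmoothFunctions n M)) := by
  refine IsUnit.of_mul_eq_one ⟨fun x ↦ ((s : SmoothFunctions n M) x)⁻¹, fun x ↦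
    ((restrict U (s : SmoothFunctions n M)).contMDiff x).inv₀ (s.2 x x.2)⟩ ?_
  ext x
  exact mul_inv_cancel₀ (s.2 x x.2)

/-- The comparison map `S_U⁻¹ C^∞(M) → C^∞(U)`, `f / s ↦ f|_U / s|_U`. -/
def fromLocalization (U : Opens M) :
    Localization (nonvanishing n U) →+* SmoothFunctions n U :=
  IsLocalization.lift (M := nonvanishing n U) (g := restrict U) isUnit_restrict

theorem fromLocalization_mk {U : Opens M} (f : SmoothFunctions n M) (s : nonvanishing n U) (x : U) :
    fromLocalization U (Localization.mk f s) x = f x / (s : SmoothFunctions n M) x := by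
  rw [eq_div_iff (s.2 x x.2), mul_comm]
  have h := (IsLocalization.lift_mk'_spec (S := Localization (nonvanishing n U))
    (hg := isUnit_restrict (n := n) (U := U)) f _ s).1 rfl
  rw [Localization.mk_eq_mk']
  exact (DFunLike.congr_fun h x).symm

variable (n M) in
/-- The comparison map from `U ↦ S_U⁻¹ C^∞(M)` to the sheaf of smooth functions. -/
def localizationComparison : localizationPresheaf n M ⟶ (smoothSheaf n M).obj where
  app U := RingCat.ofHom (fromLocalization (unop U))
  naturality U V i := by
    ext x
    induction x using Localization.induction_on with | _ p
    refine ContMDiffMap.ext fun x ↦ ?_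
    refine (DFunLike.congr_fun (congrArg (fromLocalization (unop V))
      (localizationMap_mk (leOfHom i.unop) p.1 p.2)) x).trans ?_
    exact (fromLocalization_mk p.1 _ x).trans
      (fromLocalization_mk p.1 p.2 (Set.inclusion (leOfHom i.unop) x)).symm

theorem liftOfLE_mk (Q : ModuleCat.{u} (SmoothFunctions n M)) {U V : Opens M} (h : V ≤ U) (q : Q)
    (s : nonvanishing n U) :
    LocalizedModule.liftOfLE (nonvanishing n U) (nonvanishing n V) (nonvanishing_mono h)
      (LocalizedModule.mk q s) =
        LocalizedModule.mk q ⟨s.1, nonvanishing_mono h s.2⟩ := by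
  simpa only [IsLocalizedModule.mk_eq_mk'] using
    IsLocalizedModule.liftOfLE_mk' (nonvanishing n U) (nonvanishing n V) (nonvanishing_mono h)
      (LocalizedModule.mkLinearMap (nonvanishing n U) Q)
      (LocalizedModule.mkLinearMap (nonvanishing n V) Q) q s

/-- The restriction map `S_U⁻¹ Q → S_V⁻¹ Q` for `V ⊆ U`. -/
def localizedRestrict (Q : ModuleCat.{u} (SmoothFunctions n M)) {U V : Opens M} (h : V ≤ U) :
    LocalizedModule (nonvanishing n U) Q →ₛₗ[localizationMap (n := n) h]
      LocalizedModule (nonvanishing n V) Q where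
  toFun := LocalizedModule.liftOfLE (nonvanishing n U) (nonvanishing n V) (nonvanishing_mono h)
  map_add' := map_add _
  map_smul' a x := by
    induction a using Localization.induction_on with | _ p
    induction x using LocalizedModule.induction_on with | _ q s
    rw [LocalizedModule.mk_smul_mk, liftOfLE_mk Q h, liftOfLE_mk Q h, localizationMap_mk,
      LocalizedModule.mk_smul_mk]
    rfl

/-- The presheaf of modules `U ↦ S_U⁻¹ Q` over `U ↦ S_U⁻¹ C^∞(M)`. -/
def localizedPresheaf (Q : ModuleCat.{u} (SmoothFunctions n M)) :
    PresheafOfModules.{u} (localizationPresheaf n M) where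
  obj U := ModuleCat.of (Localization (nonvanishing n (unop U)))
    (LocalizedModule (nonvanishing n (unop U)) Q)
  map {U V} i := ModuleCat.semilinearMapAddEquiv ((localizationPresheaf n M).map i).hom _
    (ModuleCat.of (Localization (nonvanishing n (unop V))) _)
      (localizedRestrict Q (leOfHom i.unop))
  map_id U := by
    refine ConcreteCategory.hom_ext _ _ fun x ↦ ?_
    induction x using LocalizedModule.induction_on with | _ q s
    exact liftOfLE_mk Q (le_refl (unop U)) q s
  map_comp i j := by
    refine ConcreteCategory.hom_ext _ _ fun x ↦ ?_
    induction x using LocalizedModule.induction_on with | _ q s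
    exact (liftOfLE_mk Q (leOfHom (i ≫ j).unop) q s).trans
      ((congrArg (localizedRestrict Q (leOfHom j.unop)) (liftOfLE_mk Q (leOfHom i.unop) q s)).trans
        (liftOfLE_mk Q (leOfHom j.unop) q _)).symm

theorem exists_bump [T2Space M] {U : Opens M} {x : M} (hx : x ∈ U) :
    ∃ χ : SmoothBumpFunction (𝓡 n) x, tsupport χ ⊆ U := by
  obtain ⟨χ, -, h⟩ := (SmoothBumpFunction.nhds_basis_tsupport (I := 𝓡 n) x).mem_iff.1
    (U.isOpen.mem_nhds hx)
  exact ⟨χ, h⟩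

end Manifold

section Localization

variable {n : ℕ} {M : Type u} [TopologicalSpace M] [ChartedSpace (EuclideanSpace ℝ (Fin n)) M]
  [IsManifold (𝓡 n) ∞ M] [T2Space M]

/-- The open support of a smooth bump function. -/
def bumpOpen {x : M} (χ : SmoothBumpFunction (𝓡 n) x) : Opens M :=
  ⟨Function.support χ, χ.isOpen_support⟩

/-- A smooth bump function, as an element of the multiplicative set of its open support. -/
def bumpDenominator {x : M} (χ : SmoothBumpFunction (𝓡 n) x) : nonvanishing n (bumpOpen χ) :=
  ⟨⟨χ, χ.contMDiff⟩, fun _ hy ↦ hy⟩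

/-- The product of a smooth function on `U` with a bump function supported in `U`. -/
theorem exists_bump_mul {U : Opens M} {x : M} (χ : SmoothBumpFunction (𝓡 n) x)
    (hχ : tsupport χ ⊆ U) (h : SmoothFunctions n U) :
    ∃ f : SmoothFunctions n M, ∀ y : U, f y = χ y * h y := by
  classical
  let f : M → ℝ := fun y ↦ if hy : y ∈ U then χ y * h ⟨y, hy⟩ else 0
  have hf : ∀ y : U, f y = χ y * h y := fun y ↦ dif_pos y.2
  refine ⟨⟨f, contMDiff_of_tsupport fun y hy ↦ ?_⟩, hf⟩
  have hsub : Function.support f ⊆ Function.support χ := by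
    intro z hz hz'
    refine hz ?_
    simp only [f]
    split_ifs
    · rw [hz', zero_mul]
    · rfl
  have hyU : y ∈ U := hχ (closure_mono hsub hy)
  refine (contMDiffAt_subtype_iff (U := U) (x := ⟨y, hyU⟩)).1 ?_
  have hc : ContMDiff (𝓡 n) 𝓘(ℝ, ℝ) ∞ fun y : U ↦ χ y * h y :=
    (χ.contMDiff.comp contMDiff_subtype_val).mul h.contMDiff
  exact (hc ⟨y, hyU⟩).congr_of_eventuallyEq (Filter.Eventually.of_forall hf)

instance : Presheaf.IsLocallyInjective (Opens.grothendieckTopology M)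
    (localizationComparison n M) where
  equalizerSieve_mem {U} a b h x hx := by
    obtain ⟨χ, hχ⟩ := exists_bump (n := n) hx
    have hV : bumpOpen χ ≤ unop U := (subset_tsupport _).trans hχ
    refine ⟨bumpOpen χ, homOfLE hV, ?_, χ.c_mem_support⟩
    induction a using Localization.induction_on with | _ p
    induction b using Localization.induction_on with | _ q
    refine (localizationMap_mk hV _ _).trans (Eq.trans ?_ (localizationMap_mk hV _ _).symm)
    refine Localization.mk_eq_mk_iff.2 (Localization.r_iff_exists.2 ⟨bumpDenominator χ, ?_⟩)
    refine ContMDiffMap.ext fun y ↦ ?_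
    change χ y * ((q.2 : SmoothFunctions n M) y * p.1 y) =
      χ y * ((p.2 : SmoothFunctions n M) y * q.1 y)
    by_cases hy : χ y = 0
    · rw [hy, zero_mul, zero_mul]
    · have hyU : y ∈ unop U := hV hy
      have h' : fromLocalization (unop U) (Localization.mk p.1 p.2) =
        fromLocalization (unop U) (Localization.mk q.1 q.2) := h
      have e := (fromLocalization_mk p.1 p.2 ⟨y, hyU⟩).symm.trans
        ((DFunLike.congr_fun h' ⟨y, hyU⟩).trans (fromLocalization_mk q.1 q.2 ⟨y, hyU⟩))
      rw [div_eq_div_iff (p.2.2 y hyU) (q.2.2 y hyU)] at e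
      rw [mul_comm _ (p.1 y), e, mul_comm (q.1 y)]

instance : Presheaf.IsLocallySurjective (Opens.grothendieckTopology M)
    (localizationComparison n M) where
  imageSieve_mem {U} a x hx := by
    obtain ⟨χ, hχ⟩ := exists_bump (n := n) hx
    have hV : bumpOpen χ ≤ U := (subset_tsupport _).trans hχ
    obtain ⟨f, hf⟩ := exists_bump_mul χ hχ a
    refine ⟨bumpOpen χ, homOfLE hV, ⟨Localization.mk f (bumpDenominator χ), ?_⟩, χ.c_mem_support⟩
    refine ContMDiffMap.ext fun y ↦ (fromLocalization_mk f (bumpDenominator χ) y).trans ?_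
    rw [div_eq_iff ((bumpDenominator χ).2 y y.2)]
    exact (hf ⟨y, hV y.2⟩).trans (mul_comm _ _)

/-- The localization functor on objects: `L(Q)` is the sheaf of modules over the sheaf of smooth
functions associated with the presheaf `U ↦ S_U⁻¹ Q`. -/
def localization (Q : ModuleCat.{u} (SmoothFunctions n M)) : SheafOfModules.{u} (smoothSheaf n M) :=
  (PresheafOfModules.sheafification (localizationComparison n M)).obj (localizedPresheaf Q)

/-- The sections `s i` over `U` generate the restriction to `U` of the sheaf of modules `S`: every
section of `S` over an open subset `V` of `U` is locally a linear combination of the `s i` with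
smooth coefficients. Equivalently, the induced morphism of sheaves from the free module on `U` to
the restriction of `S` is an epimorphism. -/
def Generates (S : SheafOfModules.{u} (smoothSheaf n M)) (U : Opens M) {k : ℕ}
    (s : Fin k → S.val.obj (op U)) : Prop :=
  ∀ (V : Opens M) (hV : V ≤ U) (t : S.val.obj (op V)), ∀ x ∈ V, ∃ (W : Opens M) (hW : W ≤ V),
    x ∈ W ∧ S.val.map (homOfLE hW).op t ∈ Submodule.span ((smoothSheaf n M).obj.obj (op W))
      (Set.range fun i ↦ S.val.map (homOfLE (hW.trans hV)).op (s i))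

/-- A sheaf of modules is locally finitely generated (of finite type) if every point has an open
neighbourhood on which it is generated by finitely many sections. -/
def IsLocallyFinitelyGeneratedSheaf (S : SheafOfModules.{u} (smoothSheaf n M)) : Prop :=
  ∀ x : M, ∃ (U : Opens M) (k : ℕ) (s : Fin k → S.val.obj (op U)), x ∈ U ∧ Generates S U s

/-- A `C^∞(M)`-module is locally finitely generated if its localization is. -/
def IsLocallyFinitelyGenerated (Q : ModuleCat.{u} (SmoothFunctions n M)) : Prop :=
  IsLocallyFinitelyGeneratedSheaf (localization Q)

variable (n M) in
/-- The locally finitely generated, global and fiber-determined `C^∞(M)`-modules. -/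
def IsSerreSwanModule : ObjectProperty (ModuleCat.{u} (SmoothFunctions n M)) := fun Q ↦
  IsLocallyFinitelyGenerated Q ∧ IsGlobal Q ∧ IsFiberDetermined Q

end Localization

end SerreSwan

end

open SerreSwan

/-!
The section functor takes values in the modules in question, it is fully faithful, and every such
module is the module of sections of the VB-tepui of its fibres.

*Structure of VB-tepui.* Everything about a VB-tepui `E` follows from local frames
(`VBTepui.exists_local_frame`): near each `m : M` there are global sections `s i` whose values at
`m` form a basis of the fibre and such that every plot over a neighbourhood of `m` is locally a
linear combination of the `s i` with smooth coefficients. To find them, one extends a linearly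
independent family of vectors over `m` to sections, which is possible because the projection is a
local subduction (`VBTepui.exists_section_eq`), and lifts the map `Q : (x, t) ↦ ∑ t i • s i (x)` to
a minimal chart at the zero vector over `m`. The lift of a line `t ↦ t • v` in the fibre has nonzero
velocity unless `v = 0`: translations along a section through `v` lift to the chart and transport
the velocity at `0` to nearby times, so that a lift with vanishing velocity at `0` is constant
(`VBTepui.CenteredChart.eq_zero_of_deriv_eq_zero`). Hence the lift of `Q` is an immersion, and the
fibres are finite-dimensional. Conversely, as the chart is injective on its fibre over `m`, this
fibre is covered by countably many smooth images of `ℝ ^ d`, where `d` is the dimension of the fibre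
of `E`; comparing Hausdorff dimensions, the domain of the chart has dimension at most `n + d`. So
the lift of `Q` is a local diffeomorphism, and plots through zero vectors over points near `m` are
smooth combinations of the `s i`. An arbitrary plot `a` is treated by applying this to
`(l, z) ↦ l • a z` at `l = 0` and dividing by a small `l ≠ 0`.

*Sections.* Multiplying the coefficients by cutoff functions, the `s i` generate the stalks of the
module of sections near `m`. So this module is locally finitely generated, and a linear map between
modules of sections acts on the values of sections at each point, which makes the functor full. The
module is global because sections over open sets form a sheaf, and it is fibre-determined because a
section in `I_m Γ(E)` vanishes at `m`.

*Modules.* Local finite generation of a module `Q` is translated into the existence, near each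
point, of finitely many elements generating the stalks (`GeneratesAt`). By Nakayama's lemma, their
values at a given point `m` can be taken to be a basis of `Q / I_m Q` (`exists_module_frame`). The
disjoint union of the fibres `Q / I_m Q`, with plots the local combinations of elements of `Q` with
smooth coefficients, then is a VB-tepui (`fiberTepui`), with the minimal charts
`(x, t) ↦ ∑ t i • q i (x)`. The map from `Q` to its sections is injective if `Q` is
fibre-determined. If `Q` is moreover the module of global sections of a sheaf `S`, then an element
of `Q` restricts to zero in `S` over an open set if and only if its values there vanish; so the
elements of `Q` which represent a given section locally can be glued in `S`, and the map is
surjective (`fiberSection_surjective`).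
-/

noncomputable section

namespace SerreSwan

local notation "𝔼" k:max => EuclideanSpace ℝ (Fin k)

/-! ### Smooth families, parametrizations and a dimension estimate -/

section Retraction

variable {V : Type*} [NormedAddCommGroup V] [NormedSpace ℝ V] [FiniteDimensional ℝ V]

/-- A smooth map of the whole space into a neighbourhood of a point which is the identity near this
point. Precomposition with it extends germs of plots to plots on the whole space. -/
theorem exists_contDiff_retract {u : Set V} (hu : IsOpen u) {x : V} (hx : x ∈ u) :
    ∃ ρ : V → V, ContDiff ℝ ∞ ρ ∧ (∀ y, ρ y ∈ u) ∧ ∀ᶠ y in 𝓝 x, ρ y = y := by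
  obtain ⟨ε, hε, hsub⟩ := Metric.isOpen_iff.mp hu x hx
  let χ : ContDiffBump x := ⟨ε / 2, ε, by positivity, by linarith⟩
  refine ⟨fun y ↦ x + χ y • (y - x), ?_, fun y ↦ hsub ?_, ?_⟩
  · exact contDiff_const.add (χ.contDiff.smul (contDiff_id.sub contDiff_const))
  · rw [Metric.mem_ball, dist_eq_norm, add_sub_cancel_left, norm_smul, Real.norm_eq_abs,
      abs_of_nonneg χ.nonneg]
    by_cases hy : dist y x < ε
    · rw [dist_eq_norm] at hy
      exact lt_of_le_of_lt (mul_le_of_le_one_left (norm_nonneg _) χ.le_one) hy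
    · rw [χ.zero_of_le_dist (not_lt.1 hy), zero_mul]
      exact hε
  · filter_upwards [χ.eventuallyEq_one] with y hy
    simp [hy]

end Retraction

section Plots

variable {X Y : Type*} [DiffeologicalSpace X] [DiffeologicalSpace Y]

theorem isPlot_of_eventuallyEq {k : ℕ} {p : 𝔼 k → X}
    (h : ∀ y, ∃ q : 𝔼 k → X, IsPlot q ∧ ∀ᶠ z in 𝓝 y, p z = q z) : IsPlot p := by
  refine DiffeologicalSpace.locality fun y ↦ ?_
  obtain ⟨q, hq, hpq⟩ := h y
  obtain ⟨u, hu, huo, hyu⟩ := eventually_nhds_iff.1 hpq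
  refine ⟨u, huo, hyu, fun {l f} hf hf' ↦ ?_⟩
  have : p ∘ f = q ∘ f := funext fun z ↦ hu _ (hf z)
  rw [this]
  exact isPlot_reparam hq hf'

/-- A map from a finite-dimensional normed space to a diffeological space is a smooth family if its
composition with every smooth map from a Euclidean space is a plot. This is smoothness with respect
to the standard diffeology of the normed space, which is not available as an instance. -/
def SmoothFamily {V : Type*} [NormedAddCommGroup V] [NormedSpace ℝ V] (f : V → X) : Prop :=
  ∀ (k : ℕ) (g : 𝔼 k → V), ContDiff ℝ ∞ g → IsPlot (f ∘ g)

variable {V W : Type*} [NormedAddCommGroup V] [NormedSpace ℝ V]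
  [NormedAddCommGroup W] [NormedSpace ℝ W]

theorem _root_.Diffeology.IsPlot.smoothFamily {k : ℕ} {p : 𝔼 k → X} (hp : IsPlot p) :
    SmoothFamily p :=
  fun _ _ hg ↦ isPlot_reparam hp hg

theorem SmoothFamily.isPlot {k : ℕ} {p : 𝔼 k → X} (hp : SmoothFamily p) : IsPlot p :=
  hp k id contDiff_id

theorem SmoothFamily.comp {f : V → X} (hf : SmoothFamily f) {g : W → V} (hg : ContDiff ℝ ∞ g) :
    SmoothFamily (f ∘ g) :=
  fun k h hh ↦ hf k (g ∘ h) (hg.comp hh)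

theorem _root_.Diffeology.DSmooth.comp_smoothFamily {φ : X → Y} (hφ : DSmooth φ) {f : V → X}
    (hf : SmoothFamily f) : SmoothFamily (φ ∘ f) :=
  fun k g hg ↦ hφ k _ (hf k g hg)

theorem SmoothFamily.contDiff [FiniteDimensional ℝ V] {ι : Type*} [Fintype ι]
    {f : V → EuclideanSpace ℝ ι} (hf : SmoothFamily f) : ContDiff ℝ ∞ f := by
  have h := (hf _ _ (toEuclidean (E := V)).symm.contDiff).contDiff.comp
    (toEuclidean (E := V)).contDiff
  have e : (f ∘ (toEuclidean (E := V)).symm) ∘ (toEuclidean (E := V)) = f := by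
    ext1 v; simp
  rwa [e] at h

/-- The lifting property of a plotwise submersion, at an arbitrary parameter and for families over
an arbitrary finite-dimensional normed space. -/
theorem IsPlotwiseSubmersion.exists_lift_family [FiniteDimensional ℝ V] {φ : X → Y}
    (hφ : IsPlotwiseSubmersion φ) {f : V → Y} (hf : SmoothFamily f) {v : V} {x : X}
    (hv : f v = φ x) :
    ∃ q : V → X, SmoothFamily q ∧ q v = x ∧ ∀ᶠ w in 𝓝 v, φ (q w) = f w := by
  let e := toEuclidean (E := V)
  obtain ⟨q, hq, hq0, hqe⟩ := hφ.exists_lift x _ (f ∘ fun y ↦ e.symm y + v)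
    (hf _ _ (e.symm.contDiff.add contDiff_const)) (by simpa using hv)
  have he : ContDiff ℝ ∞ fun w : V ↦ e (w - v) := e.contDiff.comp (contDiff_id.sub contDiff_const)
  refine ⟨q ∘ fun w ↦ e (w - v), hq.smoothFamily.comp he, by simpa using hq0, ?_⟩
  have ht : Filter.Tendsto (fun w : V ↦ e (w - v)) (𝓝 v) (𝓝 0) := by
    have := he.continuous.tendsto v
    simpa using this
  filter_upwards [ht.eventually hqe] with w hw
  simpa using hw

end Plots

section Manifold

variable {n : ℕ} {M : Type*} [TopologicalSpace M] [ChartedSpace (EuclideanSpace ℝ (Fin n)) M]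
  [IsManifold (𝓡 n) ∞ M]

/-- Every point of a manifold has arbitrarily small neighbourhoods which are parametrized by the
whole Euclidean space. -/
theorem exists_parametrization_subset {W : Set M} (hW : IsOpen W) {m : M} (hm : m ∈ W) :
    ∃ (β : 𝔼 n → M) (γ : M → 𝔼 n), Set.range β ⊆ W ∧
      ContMDiff (𝓡 n) (𝓡 n) ∞ β ∧ β 0 = m ∧ IsOpen (Set.range β) ∧
      ContMDiffOn (𝓡 n) (𝓡 n) ∞ γ (Set.range β) ∧ ∀ y, γ (β y) = y := by
  let e := chartAt (𝔼 n) m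
  obtain ⟨ε, hε, hsub⟩ := Metric.isOpen_iff.mp (e.isOpen_inter_preimage_symm hW) (e m)
    ⟨mem_chart_target _ m, by rwa [Set.mem_preimage, e.left_inv (mem_chart_source _ m)]⟩
  let b := OpenPartialHomeomorph.univBall (e m) ε
  have hbs : b.source = Set.univ := OpenPartialHomeomorph.univBall_source _ _
  have hbt : b.target = Metric.ball (e m) ε := OpenPartialHomeomorph.univBall_target _ hε
  have hb' : ∀ y, b y ∈ e.target ∩ e.symm ⁻¹' W := fun y ↦
    hsub (hbt ▸ b.map_source (by rw [hbs]; trivial))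
  have hb : ∀ y, b y ∈ e.target := fun y ↦ (hb' y).1
  have hrange : Set.range (e.symm ∘ b) = e.source ∩ e ⁻¹' Metric.ball (e m) ε := by
    ext x
    constructor
    · rintro ⟨y, rfl⟩
      refine ⟨e.map_target (hb y), ?_⟩
      simp only [Function.comp, Set.mem_preimage]
      rw [e.right_inv (hb y), ← hbt]
      exact b.map_source (by rw [hbs]; trivial)
    · rintro ⟨hx, hx'⟩
      refine ⟨b.symm (e x), ?_⟩
      simp only [Function.comp]
      rw [b.right_inv (hbt ▸ hx'), e.left_inv hx]
  refine ⟨e.symm ∘ b, b.symm ∘ e, ?_, ?_, ?_, ?_, ?_, ?_⟩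
  · rintro _ ⟨y, rfl⟩
    exact (hb' y).2
  · have h1 : ContMDiffOn (𝓡 n) (𝓡 n) ∞ e.symm e.target := contMDiffOn_chart_symm
    have h2 : ContMDiff (𝓡 n) (𝓡 n) ∞ b := OpenPartialHomeomorph.contDiff_univBall.contMDiff
    exact h1.comp_contMDiff h2 hb
  · simp only [Function.comp, b]
    rw [OpenPartialHomeomorph.univBall_apply_zero, e.left_inv (mem_chart_source _ m)]
  · rw [hrange]
    exact e.isOpen_inter_preimage Metric.isOpen_ball
  · rw [hrange]
    have h1 : ContMDiffOn (𝓡 n) (𝓡 n) ∞ e e.source := contMDiffOn_chart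
    have h2 : ContMDiffOn (𝓡 n) (𝓡 n) ∞ b.symm (Metric.ball (e m) ε) :=
      (OpenPartialHomeomorph.contDiffOn_univBall_symm (c := e m) (r := ε)).contMDiffOn
    exact h2.comp (h1.mono Set.inter_subset_left) Set.inter_subset_right
  · intro y
    simp only [Function.comp]
    rw [e.right_inv (hb y), b.left_inv (by rw [hbs]; trivial)]

theorem exists_parametrization (m : M) : ∃ (β : 𝔼 n → M) (γ : M → 𝔼 n),
    ContMDiff (𝓡 n) (𝓡 n) ∞ β ∧ β 0 = m ∧ IsOpen (Set.range β) ∧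
      ContMDiffOn (𝓡 n) (𝓡 n) ∞ γ (Set.range β) ∧ ∀ y, γ (β y) = y := by
  obtain ⟨β, γ, -, h⟩ := exists_parametrization_subset (n := n) isOpen_univ (Set.mem_univ m)
  exact ⟨β, γ, h⟩

theorem exists_cutoff [T2Space M] {U : Set M} (hU : IsOpen U) {x : M} (hx : x ∈ U) :
    ∃ χ : SmoothFunctions n M, (∀ᶠ y in 𝓝 x, χ y = 1) ∧ tsupport χ ⊆ U := by
  obtain ⟨χ, hχ⟩ := exists_bump (n := n) (U := ⟨U, hU⟩) hx
  exact ⟨⟨χ, χ.contMDiff⟩, χ.eventuallyEq_one, hχ⟩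

end Manifold

section Analysis

/-- The inverse function theorem, with an inverse which is smooth on all of its domain: the domain of
the local homeomorphism is shrunk to the open set where the derivative is invertible. -/
theorem exists_smooth_local_inverse {A B : Type*} [NormedAddCommGroup A] [NormedSpace ℝ A]
    [NormedAddCommGroup B] [NormedSpace ℝ B] [CompleteSpace A] {f : A → B} (hf : ContDiff ℝ ∞ f)
    {a : A} (e : A ≃L[ℝ] B) (he : fderiv ℝ f a = e) :
    ∃ Φ : OpenPartialHomeomorph A B, a ∈ Φ.source ∧ (∀ x, Φ x = f x) ∧
      ContDiffOn ℝ ∞ Φ.symm Φ.target := by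
  have hd : Differentiable ℝ f := hf.differentiable (by simp)
  have ha : HasFDerivAt f (e : A →L[ℝ] B) a := he ▸ (hd a).hasFDerivAt
  let Ψ := hf.contDiffAt.toOpenPartialHomeomorph f ha (by simp)
  let s : Set A := {x | fderiv ℝ f x ∈ Set.range ((↑) : (A ≃L[ℝ] B) → A →L[ℝ] B)}
  have hs : IsOpen s := ContinuousLinearEquiv.isOpen.preimage (hf.continuous_fderiv (by simp))
  refine ⟨Ψ.restrOpen s hs, ⟨?_, ?_⟩, fun x ↦ rfl, ?_⟩
  · exact hf.contDiffAt.mem_toOpenPartialHomeomorph_source ha (by simp)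
  · exact ⟨e, he.symm⟩
  · intro y hy
    have hy' := (Ψ.restrOpen s hs).map_target hy
    obtain ⟨e', he'⟩ := hy'.2
    refine ((Ψ.restrOpen s hs).contDiffAt_symm hy (f₀' := e') ?_
      hf.contDiffAt).contDiffWithinAt
    rw [he']
    exact (hd _).hasFDerivAt

/-- If the fibre of a submersion `F` through `u` is locally covered by countably many smooth images
of a vector space `D`, then its dimension is at most that of `D`. The proof compares Hausdorff
dimensions, which smooth maps do not increase. -/
theorem finrank_le_of_fiber_subset {A B D : Type*}
    [NormedAddCommGroup A] [InnerProductSpace ℝ A] [FiniteDimensional ℝ A]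
    [NormedAddCommGroup B] [NormedSpace ℝ B] [FiniteDimensional ℝ B]
    [NormedAddCommGroup D] [NormedSpace ℝ D] [FiniteDimensional ℝ D]
    {F : A → B} (hF : ContDiff ℝ ∞ F) {u : A} (hsurj : Function.Surjective (fderiv ℝ F u))
    {ι : Type*} [Countable ι] (G : ι → D → A) (hG : ∀ j, ContDiff ℝ ∞ (G j))
    (h : ∀ᶠ a in 𝓝 u, F a = F u → ∃ j, a ∈ Set.range (G j)) :
    Module.finrank ℝ A ≤ Module.finrank ℝ B + Module.finrank ℝ D := by
  let F' := fderiv ℝ F u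
  let K : Submodule ℝ A := LinearMap.ker (F' : A →ₗ[ℝ] B)
  let L : A →L[ℝ] K := K.orthogonalProjectionOnto
  have hF' : HasStrictFDerivAt F F' u := hF.contDiffAt.hasStrictFDerivAt (by simp)
  have hFL : HasStrictFDerivAt (fun a ↦ (F a, L a)) (F'.prod L) u := hF'.prodMk L.hasStrictFDerivAt
  -- `(F, L)` is open at `u`, so that the fibre of `F` is mapped by `L` onto a neighbourhood in `K`.
  have hmap := hFL.map_nhds_eq_of_surj (by
    rw [LinearMap.range_eq_top]
    rintro ⟨b, z⟩
    obtain ⟨a, ha⟩ := hsurj b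
    refine ⟨a - (L a : A) + z, ?_⟩
    have h1 : F' (L a : A) = 0 := (L a).2
    have h2 : F' (z : A) = 0 := z.2
    have h3 : L (L a : A) = L a := Submodule.orthogonalProjectionOnto_mem_subspace_eq_self _
    have h4 : L (z : A) = z := Submodule.orthogonalProjectionOnto_mem_subspace_eq_self _
    refine Prod.ext ?_ ?_
    · change F' (a - (L a : A) + z) = b
      rw [map_add, map_sub, h1, h2, sub_zero, add_zero]
      exact ha
    · change L (a - (L a : A) + z) = z
      rw [map_add, map_sub, h3, h4, sub_self, zero_add])
  have hev : ∀ᶠ w in 𝓝 (F u, L u), w.1 = F u → ∃ j, w.2 ∈ Set.range (fun d ↦ L (G j d)) := by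
    rw [← hmap, Filter.eventually_map]
    filter_upwards [h] with a ha hFa
    obtain ⟨j, d, hd⟩ := ha hFa
    exact ⟨j, d, congrArg L hd⟩
  have hev' : ∀ᶠ z in 𝓝 (L u), ∃ j, z ∈ Set.range (fun d ↦ L (G j d)) := by
    have ht : Filter.Tendsto (fun z : K ↦ (F u, z)) (𝓝 (L u)) (𝓝 (F u, L u)) :=
      (Continuous.prodMk_right (F u)).tendsto _
    filter_upwards [ht.eventually hev] with z hz using hz rfl
  have hdim : ((Module.finrank ℝ K : ℕ) : ENNReal) ≤ (Module.finrank ℝ D : ℕ) := by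
    rw [← Real.dimH_of_mem_nhds hev']
    have hsub : {z : K | ∃ j, z ∈ Set.range (fun d ↦ L (G j d))} =
        ⋃ j, Set.range (fun d ↦ L (G j d)) := by
      ext z; simp
    rw [hsub, dimH_iUnion]
    refine iSup_le fun j ↦ ?_
    exact ((L.contDiff.comp (hG j)).of_le (by simp)).dimH_range_le
  have hK : Module.finrank ℝ K ≤ Module.finrank ℝ D := by exact_mod_cast hdim
  have hrk := LinearMap.finrank_range_add_finrank_ker (F' : A →ₗ[ℝ] B)
  have hr := Submodule.finrank_le (LinearMap.range (F' : A →ₗ[ℝ] B))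
  change _ + Module.finrank ℝ K = _ at hrk
  omega

end Analysis

/-! ### Plots and sections of VB-tepui -/

namespace VBTepui

variable {n : ℕ} {M : Type u} [TopologicalSpace M] [ChartedSpace (EuclideanSpace ℝ (Fin n)) M]
  {E : VBTepui n M} {V : Type*} [NormedAddCommGroup V] [NormedSpace ℝ V]

theorem contMDiff_proj {k : ℕ} {a : 𝔼 k → E.Total} (ha : IsPlot a) :
    ContMDiff (𝓡 k) (𝓡 n) ∞ fun y ↦ (a y).1 :=
  E.dSmooth_proj k a ha

theorem contMDiff_proj_family [FiniteDimensional ℝ V] {a : V → E.Total} (ha : SmoothFamily a) :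
    ContMDiff 𝓘(ℝ, V) (𝓡 n) ∞ fun v ↦ (a v).1 := by
  have h := (contMDiff_proj (ha _ _ (toEuclidean (E := V)).symm.contDiff)).comp
    (toEuclidean (E := V)).contDiff.contMDiff
  have e : (fun y ↦ ((a ∘ (toEuclidean (E := V)).symm) y).1) ∘ (toEuclidean (E := V)) =
    fun v ↦ (a v).1 := by ext1 v; simp
  rwa [e] at h

theorem isPlot_zero {k : ℕ} {b : 𝔼 k → M} (hb : ContMDiff (𝓡 k) (𝓡 n) ∞ b) :
    IsPlot fun y ↦ (⟨b y, 0⟩ : E.Total) :=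
  E.dSmooth_zero k b hb

theorem isPlot_section (s : E.Section) {k : ℕ} {b : 𝔼 k → M} (hb : ContMDiff (𝓡 k) (𝓡 n) ∞ b) :
    IsPlot fun y ↦ (⟨b y, s.toFun (b y)⟩ : E.Total) :=
  s.dSmooth k b hb

theorem isPlot_smul {k : ℕ} {c : 𝔼 k → ℝ} (hc : ContDiff ℝ ∞ c) {a : 𝔼 k → E.Total}
    (ha : IsPlot a) : IsPlot fun y ↦ (⟨(a y).1, c y • (a y).2⟩ : E.Total) :=
  E.dSmooth_smul k (fun y ↦ (c y, a y)) ⟨hc.isPlot, ha⟩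

theorem isPlot_add {k : ℕ} {b : 𝔼 k → M} {a a' : ∀ y, E.Fiber (b y)}
    (ha : IsPlot fun y ↦ (⟨b y, a y⟩ : E.Total)) (ha' : IsPlot fun y ↦ (⟨b y, a' y⟩ : E.Total)) :
    IsPlot fun y ↦ (⟨b y, a y + a' y⟩ : E.Total) := by
  let _ : DiffeologicalSpace (Σ m, E.Fiber m × E.Fiber m) := inducedDiffeology
    fun e ↦ ((⟨e.1, e.2.1⟩, ⟨e.1, e.2.2⟩) : (Σ m, E.Fiber m) × (Σ m, E.Fiber m))
  exact E.dSmooth_add k (fun y ↦ ⟨b y, a y, a' y⟩) ⟨ha, ha'⟩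

/-- The linear combination of finitely many sections at a point of the base. -/
def comb {d : ℕ} (s : Fin d → E.Section) (x : M) (c : Fin d → ℝ) : E.Total :=
  ⟨x, ∑ i, c i • (s i).toFun x⟩

theorem comb_zero {d : ℕ} (s : Fin d → E.Section) (x : M) : comb s x 0 = ⟨x, 0⟩ := by
  simp [comb]

theorem isPlot_comb {d k : ℕ} (s : Fin d → E.Section) {b : 𝔼 k → M}
    (hb : ContMDiff (𝓡 k) (𝓡 n) ∞ b) {c : 𝔼 k → Fin d → ℝ} (hc : ContDiff ℝ ∞ c) :
    IsPlot fun y ↦ comb s (b y) (c y) := by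
  classical
  have h : ∀ t : Finset (Fin d),
      IsPlot fun y ↦ (⟨b y, ∑ i ∈ t, c y i • (s i).toFun (b y)⟩ : E.Total) := by
    intro t
    induction t using Finset.induction_on with
    | empty => simpa using isPlot_zero hb
    | insert i t hi ih =>
      simp only [Finset.sum_insert hi]
      exact isPlot_add (isPlot_smul (contDiff_pi.1 hc i) (isPlot_section (s i) hb)) ih
  exact h Finset.univ

theorem smoothFamily_smul {c : V → ℝ} (hc : ContDiff ℝ ∞ c) {a : V → E.Total}
    (ha : SmoothFamily a) : SmoothFamily fun v ↦ (⟨(a v).1, c v • (a v).2⟩ : E.Total) :=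
  fun k g hg ↦ isPlot_smul (hc.comp hg) (ha k g hg)

theorem smoothFamily_add_section (s : E.Section) {c : V → ℝ} (hc : ContDiff ℝ ∞ c)
    {a : V → E.Total} (ha : SmoothFamily a) :
    SmoothFamily fun v ↦ (⟨(a v).1, (a v).2 + c v • s.toFun (a v).1⟩ : E.Total) := fun k g hg ↦
  isPlot_add (ha k g hg)
    (isPlot_smul (hc.comp hg) (isPlot_section s (contMDiff_proj (ha k g hg))))

theorem smoothFamily_comb {d : ℕ} (s : Fin d → E.Section) {b : V → M}
    (hb : ContMDiff 𝓘(ℝ, V) (𝓡 n) ∞ b) {c : V → Fin d → ℝ} (hc : ContDiff ℝ ∞ c) :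
    SmoothFamily fun v ↦ comb s (b v) (c v) :=
  fun _ _ hg ↦ isPlot_comb s (hb.comp hg.contMDiff) (hc.comp hg)

/-- Every element of the total space is the value of a global smooth section: the inverse of a
parametrization of the base lifts to a local section, which is cut off. -/
theorem exists_section_eq [IsManifold (𝓡 n) ∞ M] [T2Space M] (m : M) (v : E.Fiber m) :
    ∃ s : E.Section, s.toFun m = v := by
  classical
  obtain ⟨β, γ, hβ, hβ0, hβo, hγ, hγβ⟩ := exists_parametrization (n := n) m
  let _ := manifoldDiffeology n M
  obtain ⟨q, hq, hq0, hqe⟩ := E.isTepuiFibration.isLocalSubduction.exists_lift ⟨m, v⟩ n β hβ hβ0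
  obtain ⟨O, hO, hOo, h0O⟩ := eventually_nhds_iff.1 hqe
  let U : Set M := Set.range β ∩ γ ⁻¹' O
  have hU : IsOpen U := hγ.continuousOn.isOpen_inter_preimage hβo hOo
  have hmU : m ∈ U := ⟨⟨0, hβ0⟩, by rw [← hβ0, Set.mem_preimage, hγβ]; exact h0O⟩
  obtain ⟨χ, hχ1, hχU⟩ := exists_cutoff (n := n) hU hmU
  have hqγ : ∀ x ∈ U, (q (γ x)).1 = x := by
    rintro x ⟨⟨y, rfl⟩, hx⟩
    rw [Set.mem_preimage, hγβ] at hx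
    rw [hγβ]
    exact hO y hx
  -- The germ `q ∘ γ` lies over the identity on `U` only; elsewhere the value is irrelevant since
  -- `χ` vanishes there.
  let s : ∀ x, E.Fiber x := fun x ↦ if h : (q (γ x)).1 = x then χ x • (h ▸ (q (γ x)).2) else 0
  have hs : ∀ x, (q (γ x)).1 = x → (⟨x, s x⟩ : E.Total) = ⟨(q (γ x)).1, χ x • (q (γ x)).2⟩ := by
    intro x h
    have key : ∀ (e : E.Total) (h : e.1 = x), (⟨x, χ x • (h ▸ e.2)⟩ : E.Total) =
        ⟨e.1, χ x • e.2⟩ := by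
      rintro ⟨_, w⟩ rfl
      rfl
    simp only [s, dif_pos h]
    exact key _ h
  have hs0 : ∀ x, χ x = 0 → s x = 0 := by
    intro x hx
    simp only [s]
    split_ifs
    · rw [hx, zero_smul]
    · rfl
  refine ⟨⟨s, fun k p hp ↦ isPlot_of_eventuallyEq fun y ↦ ?_⟩, ?_⟩
  · have hp' : ContMDiff (𝓡 k) (𝓡 n) ∞ p := hp
    by_cases hy : p y ∈ U
    · obtain ⟨ρ, hρ, hρU, hρe⟩ := exists_contDiff_retract (hU.preimage hp'.continuous) hy
      have hpρ : ContMDiff (𝓡 k) (𝓡 n) ∞ (p ∘ ρ) := hp'.comp hρ.contMDiff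
      refine ⟨fun z ↦ ⟨(q (γ (p (ρ z)))).1, χ (p (ρ z)) • (q (γ (p (ρ z)))).2⟩,
        isPlot_smul (χ.contMDiff.comp hpρ).contDiff (a := fun z ↦ q (γ (p (ρ z)))) ?_, ?_⟩
      · exact isPlot_reparam (f := fun z ↦ γ (p (ρ z))) hq
          (hγ.comp_contMDiff hpρ fun z ↦ (hρU z).1).contDiff
      · filter_upwards [hρe] with z hz
        have hzU : p z ∈ U := hz ▸ hρU z
        rw [hz]
        exact hs _ (hqγ _ hzU)
    · have hy' : p y ∈ (tsupport χ)ᶜ := fun h ↦ hy (hχU h)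
      refine ⟨fun z ↦ ⟨p z, 0⟩, isPlot_zero hp', ?_⟩
      filter_upwards [((isClosed_tsupport χ).isOpen_compl.preimage hp'.continuous).mem_nhds hy']
        with z hz
      have : s (p z) = 0 := hs0 _ (image_eq_zero_of_notMem_tsupport hz)
      simp only [Function.comp, this]
  · have h1 := hs m (hqγ m hmU)
    have h2 : γ m = 0 := by rw [← hβ0, hγβ]
    rw [h2, hχ1.self_of_nhds, hq0, one_smul] at h1
    exact eq_of_heq (Sigma.mk.inj h1).2

end VBTepui

/-! ### Minimal charts at zero vectors -/

namespace VBTepui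

variable {n : ℕ} {M : Type u} [TopologicalSpace M] [ChartedSpace (EuclideanSpace ℝ (Fin n)) M]

/-- A minimal chart of a VB-tepui at `e`, centred at the parameter `center` of `e`. The chart is
extended to all of the Euclidean space by arbitrary values outside its domain. Smoothness and the
lifting property are recorded for families parametrized by normed spaces. -/
structure CenteredChart (E : VBTepui n M) (e : E.Total) where
  /-- the dimension of the domain -/
  k : ℕ
  /-- the domain -/
  U : Set (𝔼 k)
  /-- the chart -/
  P : 𝔼 k → E.Total
  /-- the parameter of the point `e` -/
  center : 𝔼 k
  isOpen : IsOpen U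
  center_mem : center ∈ U
  map_center : P center = e
  smoothFamily : ∀ {V : Type} [NormedAddCommGroup V] [NormedSpace ℝ V] {c : V → 𝔼 k},
    ContDiff ℝ ∞ c → (∀ v, c v ∈ U) → SmoothFamily fun v ↦ P (c v)
  exists_lift : ∀ {V : Type} [NormedAddCommGroup V] [NormedSpace ℝ V] [FiniteDimensional ℝ V]
    {f : V → E.Total} {v : V} {u : 𝔼 k}, SmoothFamily f → u ∈ U → f v = P u →
      ∃ c : V → 𝔼 k, ContDiff ℝ ∞ c ∧ (∀ w, c w ∈ U) ∧ c v = u ∧ ∀ᶠ w in 𝓝 v, P (c w) = f w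
  inj : ∀ {u u' : 𝔼 k}, u ∈ U → u' ∈ U → (P u).1 = e.1 → P u = P u' → u = u'

variable {E : VBTepui n M}

theorem nonempty_centeredChart (e : E.Total) : Nonempty (CenteredChart E e) := by
  classical
  let _ := manifoldDiffeology n M
  obtain ⟨k, U, p, hp⟩ := E.isTepuiFibration.exists_minimalChart e
  obtain ⟨u, hu⟩ := hp.mem_range
  let P : 𝔼 k → E.Total := fun v ↦ if h : v ∈ U then p ⟨v, h⟩ else e
  have hP : ∀ v (h : v ∈ U), P v = p ⟨v, h⟩ := fun v h ↦ dif_pos h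
  refine ⟨⟨k, U, P, u, hp.isOpen, u.2, (hP u u.2).trans hu, ?_, ?_, ?_⟩⟩
  · intro V _ _ c hc hcU
    have : (fun v ↦ P (c v)) = p ∘ fun v ↦ ⟨c v, hcU v⟩ := funext fun v ↦ hP _ (hcU v)
    rw [this]
    exact hp.isPlotwiseSubmersion.dSmooth.comp_smoothFamily
      fun l g hg ↦ show IsPlot (fun v ↦ c (g v)) from (hc.comp hg).isPlot
  · intro V _ _ _ f v u hf hu' hv
    obtain ⟨q, hq, hqv, hqe⟩ := hp.isPlotwiseSubmersion.exists_lift_family (x := ⟨u, hu'⟩) hf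
      (hv.trans (hP u hu'))
    refine ⟨fun w ↦ q w, SmoothFamily.contDiff fun l g hg ↦ hq l g hg, fun w ↦ (q w).2,
      congrArg Subtype.val hqv, ?_⟩
    filter_upwards [hqe] with w hw
    rw [hP _ (q w).2]
    exact hw
  · intro u u' hu hu' h1 h2
    rw [hP u hu] at h1 h2
    rw [hP u' hu'] at h2
    exact congrArg Subtype.val (hp.injOn (x₁ := ⟨u, hu⟩) (x₂ := ⟨u', hu'⟩) h1
      (show (p ⟨u', hu'⟩).1 = e.1 from h2 ▸ h1) h2)

namespace CenteredChart

/-- In a parametrization `β` of the base, the projection is given near the centre of a chart by a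
smooth map. -/
theorem exists_base_coordinate {e : E.Total} (C : CenteredChart E e) {β : 𝔼 n → M} {γ : M → 𝔼 n}
    (hβ0 : β 0 = e.1) (hβo : IsOpen (Set.range β))
    (hγ : ContMDiffOn (𝓡 n) (𝓡 n) ∞ γ (Set.range β)) (hγβ : ∀ y, γ (β y) = y) :
    ∃ F : 𝔼 C.k → 𝔼 n, ContDiff ℝ ∞ F ∧ F C.center = 0 ∧
      ∀ᶠ u in 𝓝 C.center, (C.P u).1 = β (F u) := by
  obtain ⟨ρ, hρ, hρU, hρe⟩ := exists_contDiff_retract C.isOpen C.center_mem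
  have hh : ContMDiff 𝓘(ℝ, 𝔼 C.k) (𝓡 n) ∞ fun u ↦ (C.P (ρ u)).1 :=
    contMDiff_proj_family (C.smoothFamily hρ hρU)
  have h0 : C.center ∈ (fun u ↦ (C.P (ρ u)).1) ⁻¹' Set.range β :=
    ⟨0, by
      change β 0 = (C.P (ρ C.center)).1
      rw [hβ0, hρe.self_of_nhds, C.map_center]⟩
  obtain ⟨τ, hτ, hτU, hτe⟩ := exists_contDiff_retract (hβo.preimage hh.continuous) h0
  have hF : ∀ᶠ u in 𝓝 C.center, (C.P u).1 = β (γ (C.P (ρ (τ u))).1) := by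
    filter_upwards [hρe, hτe] with u h1 h2
    obtain ⟨y, hy⟩ := hτU u
    simp only [h2, h1] at hy ⊢
    rw [← hy, hγβ]
  refine ⟨fun u ↦ γ (C.P (ρ (τ u))).1,
    (hγ.comp_contMDiff (hh.comp hτ.contMDiff) hτU).contDiff, ?_, hF⟩
  change γ (C.P (ρ (τ C.center))).1 = 0
  rw [hτe.self_of_nhds, hρe.self_of_nhds, C.map_center, ← hβ0, hγβ]

/-- A lift of the line `t ↦ t • v` to a minimal chart is immersed unless `v = 0`. Translation along
a section through `v` lifts to the chart, and it moves the velocity at `0` to the velocities at all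
small times; if the former vanishes, the lift is constant. -/
theorem eq_zero_of_deriv_eq_zero [IsManifold (𝓡 n) ∞ M] [T2Space M] {m : M} {v : E.Fiber m}
    (C : CenteredChart E ⟨m, 0⟩) {c : ℝ → 𝔼 C.k} (hc : ContDiff ℝ ∞ c) (hcU : ∀ t, c t ∈ C.U)
    (hc0 : c 0 = C.center) (hcv : ∀ᶠ t in 𝓝 (0 : ℝ), C.P (c t) = ⟨m, t • v⟩)
    (hd : deriv c 0 = 0) : v = 0 := by
  obtain ⟨s, hs⟩ := exists_section_eq (E := E) m v
  obtain ⟨ρ, hρ, hρU, hρe⟩ := exists_contDiff_retract C.isOpen C.center_mem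
  -- `T` lifts the translations `e ↦ e + t • s` to the chart.
  let g : E.Total → ℝ → E.Total := fun e t ↦ ⟨e.1, e.2 + t • s.toFun e.1⟩
  let f : ℝ × 𝔼 C.k → E.Total := fun w ↦ g (C.P (ρ w.2)) w.1
  have hf : SmoothFamily f := smoothFamily_add_section s contDiff_fst
    (C.smoothFamily (hρ.comp contDiff_snd) fun w ↦ hρU w.2)
  have hf0 : f (0, C.center) = C.P C.center := by
    change g (C.P (ρ C.center)) 0 = C.P C.center
    rw [hρe.self_of_nhds]
    simp only [g, zero_smul, add_zero]
  obtain ⟨T, hT, hTU, -, hTe⟩ := C.exists_lift hf C.center_mem hf0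
  have hcont := hc.continuous
  -- By the injectivity of the chart on the fibre over `m`, the lift `T` shifts the curve `c`.
  have hev : ∀ᶠ w in 𝓝 ((0 : ℝ), (0 : ℝ)), T (w.1, c w.2) = c (w.1 + w.2) := by
    have t1 : Filter.Tendsto (fun w : ℝ × ℝ ↦ (w.1, c w.2)) (𝓝 (0, 0)) (𝓝 (0, C.center)) := by
      have : Continuous fun w : ℝ × ℝ ↦ (w.1, c w.2) := by fun_prop
      simpa only [hc0] using this.tendsto (0, 0)
    have t2 : Filter.Tendsto (fun w : ℝ × ℝ ↦ c w.2) (𝓝 (0, 0)) (𝓝 C.center) := by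
      have : Continuous fun w : ℝ × ℝ ↦ c w.2 := by fun_prop
      simpa only [hc0] using this.tendsto (0, 0)
    have t3 : Filter.Tendsto (fun w : ℝ × ℝ ↦ w.2) (𝓝 (0, 0)) (𝓝 0) := continuous_snd.tendsto _
    have t4 : Filter.Tendsto (fun w : ℝ × ℝ ↦ w.1 + w.2) (𝓝 (0, 0)) (𝓝 0) := by
      have : Continuous fun w : ℝ × ℝ ↦ w.1 + w.2 := by fun_prop
      simpa only [add_zero] using this.tendsto (0, 0)
    filter_upwards [t1.eventually hTe, t2.eventually hρe, t3.eventually hcv, t4.eventually hcv]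
      with w h1 h2 h3 h4
    have h5 : C.P (T (w.1, c w.2)) = C.P (c (w.1 + w.2)) := by
      rw [h1, h4]
      change g (C.P (ρ (c w.2))) w.1 = _
      rw [h2, h3]
      simp only [g, hs]
      rw [← add_smul, add_comm]
    exact C.inj (hTU _) (hcU _) (by rw [h5, h4]) h5
  have hderiv : ∀ᶠ t in 𝓝 (0 : ℝ), deriv c t = 0 := by
    rw [nhds_prod_eq] at hev
    filter_upwards [hev.curry] with t ht
    have hTt : DifferentiableAt ℝ (fun u ↦ T (t, u)) (c 0) :=
      ((hT.comp (contDiff_prodMk_right t)).differentiable (by simp)) _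
    have hc' : HasDerivAt c 0 0 := hd ▸ (hc.differentiable (by simp) 0).hasDerivAt
    have h1 : deriv (fun l ↦ T (t, c l)) 0 = 0 := by
      have := (hTt.hasFDerivAt.comp_hasDerivAt (0 : ℝ) hc').deriv
      rw [map_zero] at this
      exact this
    have h2 : deriv (fun l ↦ T (t, c l)) 0 = deriv (fun l ↦ c (t + l)) 0 :=
      Filter.EventuallyEq.deriv_eq ht
    rw [h2, deriv_comp_const_add, add_zero] at h1
    exact h1
  obtain ⟨ε, hε, hball⟩ := Metric.eventually_nhds_iff_ball.1 hderiv
  have hconst : ∀ᶠ t in 𝓝 (0 : ℝ), c t = C.center := by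
    filter_upwards [Metric.ball_mem_nhds (0 : ℝ) hε] with t ht
    rw [← hc0]
    exact Metric.isOpen_ball.is_const_of_deriv_eq_zero (convex_ball _ _).isPreconnected
      (hc.differentiable (by simp)).differentiableOn hball ht (Metric.mem_ball_self hε)
  have hnear : ∀ᶠ t in 𝓝[≠] (0 : ℝ), t ≠ 0 ∧ t • v = 0 := by
    filter_upwards [hconst.filter_mono nhdsWithin_le_nhds, hcv.filter_mono nhdsWithin_le_nhds,
      self_mem_nhdsWithin] with t h1 h2 h3
    rw [h1, C.map_center] at h2
    exact ⟨h3, (eq_of_heq (Sigma.mk.inj h2).2).symm⟩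
  obtain ⟨t, ht, htv⟩ := hnear.exists
  exact (smul_eq_zero.1 htv).resolve_left ht

end CenteredChart

end VBTepui

/-! ### Local frames of VB-tepui -/

namespace VBTepui

variable {n : ℕ} {M : Type u} [TopologicalSpace M] [ChartedSpace (EuclideanSpace ℝ (Fin n)) M]
  {E : VBTepui n M}

/-- Near zero, the linear combinations of sections over a parametrization of the base lift to a
minimal chart. -/
theorem CenteredChart.exists_lift_comb {m : M} (C : CenteredChart E ⟨m, 0⟩) {β : 𝔼 n → M}
    (hβ : ContMDiff (𝓡 n) (𝓡 n) ∞ β) (hβ0 : β 0 = m) {d : ℕ} (s : Fin d → E.Section) :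
    ∃ Q : 𝔼 n × (Fin d → ℝ) → 𝔼 C.k, ContDiff ℝ ∞ Q ∧ (∀ w, Q w ∈ C.U) ∧ Q 0 = C.center ∧
      ∀ᶠ w in 𝓝 0, C.P (Q w) = comb s (β w.1) w.2 := by
  refine C.exists_lift (f := fun w : 𝔼 n × (Fin d → ℝ) ↦ comb s (β w.1) w.2)
    (smoothFamily_comb s (hβ.comp contDiff_fst.contMDiff) contDiff_snd) C.center_mem ?_
  change comb s (β 0) 0 = _
  rw [comb_zero, hβ0, C.map_center]

/-- The dimension of the domain of a minimal chart at a zero vector is at most `n` plus the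
dimension of the fibre. Indeed, the fibre of the chart over `m` is covered by countably many smooth
images of the vector space `E.Fiber m`. -/
theorem CenteredChart.le_add_of_span {m : M} (C : CenteredChart E ⟨m, 0⟩) {β : 𝔼 n → M}
    {γ : M → 𝔼 n} (hβ : ContMDiff (𝓡 n) (𝓡 n) ∞ β) (hβ0 : β 0 = m) (hβo : IsOpen (Set.range β))
    (hγ : ContMDiffOn (𝓡 n) (𝓡 n) ∞ γ (Set.range β)) (hγβ : ∀ y, γ (β y) = y)
    {d : ℕ} {s : Fin d → E.Section}
    (hspan : ∀ v : E.Fiber m, ∃ c : Fin d → ℝ, ∑ i, c i • (s i).toFun m = v) :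
    C.k ≤ n + d := by
  obtain ⟨F, hF, hF0, hFe⟩ := C.exists_base_coordinate hβ0 hβo hγ hγβ
  obtain ⟨Q, hQ, hQU, hQ0, hQe⟩ := C.exists_lift_comb hβ hβ0 s
  let Z := {u : 𝔼 C.k // u ∈ C.U ∧ (C.P u).1 = m}
  -- Near a coefficient vector `t u` of `C.P u`, the plot `t ↦ comb s m t` lifts to the chart.
  have hZ : ∀ u : Z, ∃ (t : Fin d → ℝ) (G : (Fin d → ℝ) → 𝔼 C.k) (N : Set (Fin d → ℝ)),
      comb s m t = C.P u ∧ ContDiff ℝ ∞ G ∧ (∀ t, G t ∈ C.U) ∧ IsOpen N ∧ t ∈ N ∧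
        ∀ t ∈ N, C.P (G t) = comb s m t := by
    intro u
    have h1 : ∃ t, comb s m t = C.P u := by
      have key : ∀ e : E.Total, e.1 = m → ∃ t, comb s m t = e := by
        rintro ⟨_, v⟩ rfl
        obtain ⟨c, hc⟩ := hspan v
        exact ⟨c, congrArg (Sigma.mk _) hc⟩
      exact key _ u.2.2
    obtain ⟨t, ht⟩ := h1
    obtain ⟨G, hG, hGU, hGt, hGe⟩ := C.exists_lift
      (smoothFamily_comb s (contMDiff_const (c := m)) contDiff_id) u.2.1 ht
    obtain ⟨N, hN, hNo, htN⟩ := eventually_nhds_iff.1 hGe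
    exact ⟨t, G, N, ht, hG, hGU, hNo, htN, hN⟩
  choose t G N ht hG hGU hNo htN hN using hZ
  obtain ⟨T, hT, hTN⟩ := TopologicalSpace.isOpen_iUnion_countable N hNo
  have : Countable T := hT.to_subtype
  have hsurj : Function.Surjective (fderiv ℝ F C.center) := by
    have hFQ : (fun x : 𝔼 n ↦ F (Q (x, 0))) =ᶠ[𝓝 0] id := by
      have h1 : Filter.Tendsto (fun x : 𝔼 n ↦ (x, (0 : Fin d → ℝ))) (𝓝 0) (𝓝 0) :=
        (Continuous.prodMk_left (0 : Fin d → ℝ)).tendsto (0 : 𝔼 n)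
      have h2 : Filter.Tendsto Q (𝓝 0) (𝓝 C.center) := hQ0 ▸ hQ.continuous.tendsto 0
      filter_upwards [h1.eventually hQe, (h2.comp h1).eventually hFe] with x h3 h4
      simp only [Function.comp] at h4
      rw [h3] at h4
      have h5 : β x = β (F (Q (x, 0))) := h4
      rw [← hγβ (F (Q (x, 0))), ← h5, hγβ]
      rfl
    have hQ1 : ContDiff ℝ ∞ fun x : 𝔼 n ↦ Q (x, 0) := hQ.comp (contDiff_prodMk_left _)
    have h1 : HasFDerivAt (fun x : 𝔼 n ↦ F (Q (x, 0)))
        ((fderiv ℝ F C.center).comp (fderiv ℝ (fun x : 𝔼 n ↦ Q (x, 0)) 0)) 0 :=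
      HasFDerivAt.comp (g := F) (f := fun x : 𝔼 n ↦ Q (x, 0)) 0
        (by
          have : Q ((0 : 𝔼 n), (0 : Fin d → ℝ)) = C.center := hQ0
          rw [this]
          exact (hF.differentiable (by simp) _).hasFDerivAt)
        (hQ1.differentiable (by simp) 0).hasFDerivAt
    have h2 := (h1.congr_of_eventuallyEq hFQ.symm).unique (hasFDerivAt_id (0 : 𝔼 n))
    intro y
    exact ⟨_, DFunLike.congr_fun h2 y⟩
  have hle := finrank_le_of_fiber_subset hF hsurj (fun j : T ↦ G j) (fun j ↦ hG j) (by
    filter_upwards [hFe, C.isOpen.mem_nhds C.center_mem] with u h1 h2 h3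
    have hum : (C.P u).1 = m := by rw [h1, h3, hF0, hβ0]
    have hmem : t ⟨u, h2, hum⟩ ∈ ⋃ i ∈ T, N i := by
      rw [hTN]
      exact Set.mem_iUnion.2 ⟨_, htN ⟨u, h2, hum⟩⟩
    simp only [Set.mem_iUnion] at hmem
    obtain ⟨i, hiT, hi⟩ := hmem
    refine ⟨⟨i, hiT⟩, t ⟨u, h2, hum⟩, (C.inj h2 (hGU i _) hum ?_).symm⟩
    rw [hN i _ hi, ht])
  simpa using hle

variable [IsManifold (𝓡 n) ∞ M] [T2Space M]

/-- The lift to a minimal chart of the combinations of sections which are linearly independent at `m`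
is an immersion at zero. -/
theorem CenteredChart.injective_fderiv_lift_comb {m : M} (C : CenteredChart E ⟨m, 0⟩) {β : 𝔼 n → M}
    {γ : M → 𝔼 n} (hβ0 : β 0 = m) (hβo : IsOpen (Set.range β))
    (hγ : ContMDiffOn (𝓡 n) (𝓡 n) ∞ γ (Set.range β)) (hγβ : ∀ y, γ (β y) = y)
    {d : ℕ} {s : Fin d → E.Section} (hs : LinearIndependent ℝ fun i ↦ (s i).toFun m)
    {Q : 𝔼 n × (Fin d → ℝ) → 𝔼 C.k} (hQ : ContDiff ℝ ∞ Q) (hQU : ∀ w, Q w ∈ C.U)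
    (hQ0 : Q 0 = C.center) (hQe : ∀ᶠ w in 𝓝 0, C.P (Q w) = comb s (β w.1) w.2) :
    Function.Injective (fderiv ℝ Q 0) := by
  have hQd : HasFDerivAt Q (fderiv ℝ Q 0) 0 := (hQ.differentiable (by simp) 0).hasFDerivAt
  obtain ⟨F, hF, -, hFe⟩ := C.exists_base_coordinate hβ0 hβo hγ hγβ
  refine (injective_iff_map_eq_zero _).2 fun w hw ↦ ?_
  have hline : ∀ w : 𝔼 n × (Fin d → ℝ),
      Filter.Tendsto (fun t : ℝ ↦ t • w) (𝓝 0) (𝓝 0) := fun w ↦ by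
    have : Continuous fun t : ℝ ↦ t • w := by fun_prop
    simpa using this.tendsto 0
  have hFQ : (fun w ↦ F (Q w)) =ᶠ[𝓝 0] fun w ↦ w.1 := by
    have ht : Filter.Tendsto Q (𝓝 0) (𝓝 C.center) := hQ0 ▸ hQ.continuous.tendsto 0
    filter_upwards [ht.eventually hFe, hQe] with w h1 h2
    rw [h2] at h1
    have h3 : β w.1 = β (F (Q w)) := h1
    rw [← hγβ (F (Q w)), ← h3, hγβ]
  have hw1 : w.1 = 0 := by
    have h1 : HasFDerivAt (fun w ↦ F (Q w)) ((fderiv ℝ F (Q 0)).comp (fderiv ℝ Q 0)) 0 :=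
      (hF.differentiable (by simp) (Q 0)).hasFDerivAt.comp 0 hQd
    have h2 : HasFDerivAt (fun w : 𝔼 n × (Fin d → ℝ) ↦ w.1)
      (ContinuousLinearMap.fst ℝ (𝔼 n) (Fin d → ℝ)) 0 := hasFDerivAt_fst
    have h3 := (h1.congr_of_eventuallyEq hFQ.symm).unique h2
    have h4 := DFunLike.congr_fun h3 w
    simpa [hw] using h4.symm
  have hw2 : ∑ i, w.2 i • (s i).toFun m = 0 := by
    refine C.eq_zero_of_deriv_eq_zero (c := fun t ↦ Q (t • w))
      (hQ.comp (contDiff_id.smul contDiff_const)) (fun t ↦ hQU _) (by rw [zero_smul, hQ0]) ?_ ?_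
    · filter_upwards [(hline w).eventually hQe] with t ht
      rw [ht]
      have h1 : (t • w).1 = 0 := by simp [hw1]
      rw [h1, hβ0]
      simp [comb, Finset.smul_sum, smul_smul]
    · have h1 : HasDerivAt (fun t : ℝ ↦ t • w) w 0 := by
        simpa using (hasDerivAt_id (0 : ℝ)).smul_const w
      have h2 := (hQd.comp_hasDerivAt_of_eq (0 : ℝ) h1 (by simp)).deriv
      rw [hw] at h2
      exact h2
  have hw2' : w.2 = 0 := funext (Fintype.linearIndependent_iff.1 hs w.2 hw2)
  exact Prod.ext hw1 hw2'

/-- The fibres of a VB-tepui are finite-dimensional: a linearly independent family of `d` vectors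
yields an immersed family of dimension `n + d` in a minimal chart. -/
theorem finite_fiber (m : M) : Module.Finite ℝ (E.Fiber m) := by
  obtain ⟨C⟩ := nonempty_centeredChart (E := E) ⟨m, 0⟩
  obtain ⟨β, γ, hβ, hβ0, hβo, hγ, hγβ⟩ := exists_parametrization (n := n) m
  have hrank : Module.rank ℝ (E.Fiber m) ≤ (C.k : ℕ) := by
    refine rank_le fun t ht ↦ ?_
    choose s hs using fun i : Fin t.card ↦ exists_section_eq (E := E) m (t.equivFin.symm i).1
    obtain ⟨Q, hQ, hQU, hQ0, hQe⟩ := C.exists_lift_comb hβ hβ0 s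
    have hli : LinearIndependent ℝ fun i ↦ (s i).toFun m := by
      simp only [hs]
      exact ht.comp _ t.equivFin.symm.injective
    have hinj := C.injective_fderiv_lift_comb hβ0 hβo hγ hγβ hli hQ hQU hQ0 hQe
    have := LinearMap.finrank_le_finrank_of_injective
      (f := (fderiv ℝ Q 0 : 𝔼 n × (Fin t.card → ℝ) →ₗ[ℝ] 𝔼 C.k)) hinj
    simp only [Module.finrank_prod, finrank_euclideanSpace, Fintype.card_fin,
      Module.finrank_fintype_fun_eq_card] at this
    omega
  exact Module.rank_lt_aleph0_iff.1 (hrank.trans_lt (Cardinal.natCast_lt_aleph0))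

/-- Near a point `m`, families through zero vectors are smooth linear combinations of sections whose
values at `m` form a basis of the fibre. By the two dimension estimates, the lift to a minimal chart
of the combinations of these sections is a local diffeomorphism. -/
theorem exists_coefficients_of_zero {m : M} {d : ℕ} {s : Fin d → E.Section}
    (hli : LinearIndependent ℝ fun i ↦ (s i).toFun m)
    (hspan : ∀ v : E.Fiber m, ∃ c : Fin d → ℝ, ∑ i, c i • (s i).toFun m = v) :
    ∃ W : Set M, IsOpen W ∧ m ∈ W ∧ ∀ {V : Type} [NormedAddCommGroup V] [NormedSpace ℝ V]
      [FiniteDimensional ℝ V] {f : V → E.Total} {v : V}, SmoothFamily f → (f v).1 ∈ W →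
      (f v).2 = 0 → ∃ g : V → Fin d → ℝ, ContDiff ℝ ∞ g ∧
        ∀ᶠ w in 𝓝 v, f w = comb s (f w).1 (g w) := by
  obtain ⟨C⟩ := nonempty_centeredChart (E := E) ⟨m, 0⟩
  obtain ⟨β, γ, hβ, hβ0, hβo, hγ, hγβ⟩ := exists_parametrization (n := n) m
  obtain ⟨Q, hQ, hQU, hQ0, hQe⟩ := C.exists_lift_comb hβ hβ0 s
  have hinj := C.injective_fderiv_lift_comb hβ0 hβo hγ hγβ hli hQ hQU hQ0 hQe
  have hk := C.le_add_of_span hβ hβ0 hβo hγ hγβ hspan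
  have hfr : Module.finrank ℝ (𝔼 n × (Fin d → ℝ)) = Module.finrank ℝ (𝔼 C.k) := by
    refine le_antisymm (LinearMap.finrank_le_finrank_of_injective
      (f := (fderiv ℝ Q 0 : 𝔼 n × (Fin d → ℝ) →ₗ[ℝ] 𝔼 C.k)) hinj) ?_
    simpa using hk
  let e : (𝔼 n × (Fin d → ℝ)) ≃L[ℝ] 𝔼 C.k := (LinearEquiv.ofInjectiveOfFinrankEq
    (fderiv ℝ Q 0 : 𝔼 n × (Fin d → ℝ) →ₗ[ℝ] 𝔼 C.k) hinj hfr).toContinuousLinearEquiv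
  obtain ⟨Φ, hΦ0, hΦ, hΦs⟩ := exists_smooth_local_inverse hQ e (a := 0)
    (ContinuousLinearMap.ext fun _ ↦ rfl)
  obtain ⟨O, hO, hOo, h0O⟩ := eventually_nhds_iff.1 hQe
  let O' := O ∩ Φ.source
  have hO'o : IsOpen O' := hOo.inter Φ.open_source
  let N : Set (𝔼 n) := (fun y ↦ ((y, 0) : 𝔼 n × (Fin d → ℝ))) ⁻¹' O'
  have hNo : IsOpen N := hO'o.preimage (Continuous.prodMk_left _)
  refine ⟨Set.range β ∩ γ ⁻¹' N, hγ.continuousOn.isOpen_inter_preimage hβo hNo,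
    ⟨⟨0, hβ0⟩, ?_⟩, ?_⟩
  · rw [Set.mem_preimage, ← hβ0, hγβ]
    exact ⟨h0O, hΦ0⟩
  intro V _ _ _ f v hf hfW hfv
  obtain ⟨⟨y, hy⟩, hyN⟩ := hfW
  rw [← hy, Set.mem_preimage, hγβ] at hyN
  have hyO : (y, (0 : Fin d → ℝ)) ∈ O' := hyN
  have hfv' : f v = C.P (Q (y, 0)) := by
    rw [hO _ hyO.1]
    change f v = comb s (β y) 0
    rw [comb_zero]
    have key : ∀ e : E.Total, β y = e.1 → e.2 = 0 → e = ⟨β y, 0⟩ := by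
      rintro ⟨_, _⟩ rfl h
      exact congrArg _ h
    exact key _ hy hfv
  obtain ⟨c, hc, hcU, hcv, hce⟩ := C.exists_lift hf (hQU _) hfv'
  have himg : IsOpen (Φ '' O') := Φ.isOpen_image_of_subset_source hO'o Set.inter_subset_right
  have hcv' : v ∈ c ⁻¹' (Φ '' O') := ⟨(y, 0), hyO, by rw [hΦ, hcv]⟩
  obtain ⟨ρ, hρ, hρU, hρe⟩ := exists_contDiff_retract (himg.preimage hc.continuous) hcv'
  have hsub : ∀ w, c (ρ w) ∈ Φ.target := fun w ↦ by
    obtain ⟨z, hz, hz'⟩ := hρU w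
    rw [← hz']
    exact Φ.map_source hz.2
  refine ⟨fun w ↦ (Φ.symm (c (ρ w))).2,
    contDiff_snd.comp (hΦs.comp_contDiff (hc.comp hρ) hsub), ?_⟩
  filter_upwards [hρe, hce] with w h1 h2
  obtain ⟨z, hz, hz'⟩ := hρU w
  have h3 : f w = comb s (β z.1) z.2 := by
    rw [← h2, ← hO z hz.1, ← hΦ, hz', h1]
  rw [← hz', Φ.left_inv hz.2, h3]
  rfl

/-- The structure of a VB-tepui near a point `m` of the base: there are global sections whose
values at `m` form a basis of the fibre and which generate all plots over a neighbourhood of `m`. -/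
theorem exists_local_frame (E : VBTepui n M) (m : M) :
    ∃ (W : Set M) (d : ℕ) (s : Fin d → E.Section), IsOpen W ∧ m ∈ W ∧
      LinearIndependent ℝ (fun i ↦ (s i).toFun m) ∧
      ∀ {k : ℕ} {a : 𝔼 k → E.Total} {y : 𝔼 k}, IsPlot a → (a y).1 ∈ W →
        ∃ g : 𝔼 k → Fin d → ℝ, ContDiff ℝ ∞ g ∧ ∀ᶠ z in 𝓝 y, a z = comb s (a z).1 (g z) := by
  have := finite_fiber (E := E) m
  let b := Module.finBasis ℝ (E.Fiber m)
  choose s hs using fun i ↦ exists_section_eq (E := E) m (b i)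
  obtain ⟨W, hWo, hmW, hW⟩ := exists_coefficients_of_zero (s := s)
    (by simpa only [hs] using b.linearIndependent)
    (fun v ↦ ⟨b.repr v, by simpa only [hs] using b.sum_repr v⟩)
  refine ⟨W, _, s, hWo, hmW, by simpa only [hs] using b.linearIndependent, ?_⟩
  intro k a y ha hay
  -- The family `(l, z) ↦ l • a z` passes through a zero vector at `(0, y)`; its coefficients at a
  -- small `l ≠ 0` are divided by `l`.
  obtain ⟨g, hg, hge⟩ := hW (V := ℝ × 𝔼 k) (v := (0, y))
    (smoothFamily_smul contDiff_fst (ha.smoothFamily.comp contDiff_snd)) hay (zero_smul _ _)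
  rw [nhds_prod_eq] at hge
  have hne : ∀ᶠ l in 𝓝[≠] (0 : ℝ), l ≠ 0 := self_mem_nhdsWithin
  obtain ⟨l, hl, hl0⟩ := ((hge.curry.filter_mono nhdsWithin_le_nhds).and hne).exists
  have hgl : ContDiff ℝ ∞ fun z ↦ g (l, z) := hg.comp (contDiff_prodMk_right l)
  refine ⟨fun z ↦ l⁻¹ • g (l, z),
    contDiff_pi.2 fun i ↦ contDiff_const.mul (contDiff_pi.1 hgl i), ?_⟩
  filter_upwards [hl] with z hz
  have h2 : l • (a z).2 = ∑ i, g (l, z) i • (s i).toFun (a z).1 :=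
    eq_of_heq (Sigma.mk.inj hz).2
  have h3 : (a z).2 = ∑ i, (l⁻¹ • g (l, z)) i • (s i).toFun (a z).1 := by
    rw [← inv_smul_smul₀ hl0 (a z).2, h2, Finset.smul_sum]
    simp [smul_smul]
  exact Sigma.ext rfl (heq_of_eq h3)

end VBTepui

/-! ### Local finite generation in terms of stalks -/

section SheafRestriction

variable {n : ℕ} {M : Type u} [TopologicalSpace M] [ChartedSpace (EuclideanSpace ℝ (Fin n)) M]
  (S : SheafOfModules.{u} (smoothSheaf n M))

/-- The restriction map of a sheaf of modules, as an additive map. -/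
def sheafRestrict {U V : Opens M} (h : V ≤ U) : S.val.obj (op U) →+ S.val.obj (op V) :=
  (S.val.presheaf.map (homOfLE h).op).hom

theorem sheafRestrict_sheafRestrict {U V W : Opens M} (h : V ≤ U) (h' : W ≤ V)
    (t : S.val.obj (op U)) :
    sheafRestrict S h' (sheafRestrict S h t) = sheafRestrict S (h'.trans h) t :=
  (ConcreteCategory.congr_hom (S.val.presheaf.map_comp (homOfLE h).op (homOfLE h').op) t).symm

theorem sheafRestrict_smul {U V : Opens M} (h : V ≤ U)
    (a : (smoothSheaf n M).obj.obj (op U)) (t : S.val.obj (op U)) :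
    sheafRestrict S h (a • t) =
      ((smoothSheaf n M).obj.map (homOfLE h).op a) • sheafRestrict S h t :=
  S.val.map_smul (homOfLE h).op a t

end SheafRestriction

section LocalizedSections

variable {n : ℕ} {M : Type u} [TopologicalSpace M] [ChartedSpace (EuclideanSpace ℝ (Fin n)) M]
  [IsManifold (𝓡 n) ∞ M] [T2Space M] (Q : ModuleCat.{u} (SmoothFunctions n M))

/-- The canonical map from the localization `S_U⁻¹ Q` to the sections over `U` of the associated
sheaf. -/
def toLocalization (U : Opens M) : LocalizedModule (nonvanishing n U) Q →+
    (localization Q).val.obj (op U) :=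
  ((CategoryTheory.toSheafify (Opens.grothendieckTopology M)
    (localizedPresheaf Q).presheaf).app (op U)).hom

theorem toLocalization_restrict {U V : Opens M} (h : V ≤ U)
    (x : LocalizedModule (nonvanishing n U) Q) :
    sheafRestrict (localization Q) h (toLocalization Q U x) =
      toLocalization Q V (localizedRestrict Q h x) :=
  (NatTrans.naturality_apply (CategoryTheory.toSheafify (Opens.grothendieckTopology M)
    (localizedPresheaf Q).presheaf) (homOfLE h).op x).symm

theorem toLocalization_smul {U : Opens M} (a : Localization (nonvanishing n U))
    (x : LocalizedModule (nonvanishing n U) Q) :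
    toLocalization Q U (a • x) = (show (smoothSheaf n M).obj.obj (op U) from
      fromLocalization U a) • toLocalization Q U x :=
  ((PresheafOfModules.toSheafify (localizationComparison n M)
    (CategoryTheory.toSheafify (Opens.grothendieckTopology M)
      (localizedPresheaf Q).presheaf)).app (op U)).hom.map_smul a x

theorem toLocalization_locally_injective {U : Opens M}
    {x y : LocalizedModule (nonvanishing n U) Q} (h : toLocalization Q U x = toLocalization Q U y)
    {z : M} (hz : z ∈ U) : ∃ (V : Opens M) (hV : V ≤ U), z ∈ V ∧
      localizedRestrict Q hV x = localizedRestrict Q hV y := by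
  obtain ⟨V, i, hi, hzV⟩ := Presheaf.equalizerSieve_mem (Opens.grothendieckTopology M)
    (CategoryTheory.toSheafify (Opens.grothendieckTopology M) (localizedPresheaf Q).presheaf)
    (X := op U) x y h z hz
  exact ⟨V, leOfHom i, hzV, hi⟩

theorem toLocalization_locally_surjective {U : Opens M} (t : (localization Q).val.obj (op U))
    {z : M} (hz : z ∈ U) : ∃ (V : Opens M) (hV : V ≤ U) (x : LocalizedModule (nonvanishing n V) Q),
      z ∈ V ∧ toLocalization Q V x = sheafRestrict (localization Q) hV t := by
  obtain ⟨V, i, ⟨x, hx⟩, hzV⟩ := Presheaf.imageSieve_mem (Opens.grothendieckTopology M)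
    (CategoryTheory.toSheafify (Opens.grothendieckTopology M) (localizedPresheaf Q).presheaf)
    (U := op U) t z hz
  exact ⟨V, leOfHom i, x, hzV, hx⟩

/-- A smooth function on an open set is locally the restriction of a fraction of smooth functions on
`M`. -/
theorem exists_fraction_eq {U : Opens M} (a : (smoothSheaf n M).obj.obj (op U)) {x : M}
    (hx : x ∈ U) : ∃ (V : Opens M) (hV : V ≤ U) (b : Localization (nonvanishing n V)),
      x ∈ V ∧ (smoothSheaf n M).obj.map (homOfLE hV).op a = fromLocalization V b := by
  obtain ⟨V, i, ⟨b, hb⟩, hxV⟩ := Presheaf.imageSieve_mem (Opens.grothendieckTopology M)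
    (localizationComparison n M) (U := op U) a x hx
  exact ⟨V, leOfHom i, b, hxV, hb.symm⟩

variable {Q} in
/-- The elements `q i` generate the stalk at `x` of a module over `C^∞(M)`: up to multiplication by
a function which does not vanish at `x`, every element is a linear combination of them. -/
def GeneratesAt {k : ℕ} (q : Fin k → Q) (x : M) : Prop :=
  ∀ r : Q, ∃ f : SmoothFunctions n M, f x ≠ 0 ∧
    f • r ∈ Submodule.span (SmoothFunctions n M) (Set.range q)

theorem isLocallyFinitelyGenerated_of_generatesAt
    (h : ∀ m : M, ∃ (W : Opens M) (k : ℕ) (q : Fin k → Q), m ∈ W ∧ ∀ x ∈ W, GeneratesAt q x) :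
    IsLocallyFinitelyGenerated Q := by
  intro m
  obtain ⟨U, k, q, hmU, hq⟩ := h m
  refine ⟨U, k, fun i ↦ toLocalization Q U (LocalizedModule.mk (q i) 1), hmU, ?_⟩
  intro V hV t x hx
  obtain ⟨V₁, hV₁, y, hxV₁, hy⟩ := toLocalization_locally_surjective Q t hx
  induction y using LocalizedModule.induction_on with | _ r d
  obtain ⟨f, hfx, hf⟩ := hq x (hV hx) r
  let V₂ : Opens M := V₁ ⊓ ⟨{y | f y ≠ 0}, isOpen_ne.preimage f.contMDiff.continuous⟩
  have h₂₁ : V₂ ≤ V₁ := inf_le_left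
  refine ⟨V₂, h₂₁.trans hV₁, ⟨hxV₁, hfx⟩, ?_⟩
  let f' : nonvanishing n V₂ := ⟨f, fun y hy ↦ hy.2⟩
  let d' : nonvanishing n V₂ := ⟨d, nonvanishing_mono h₂₁ d.2⟩
  have hspan : ∀ r' ∈ Submodule.span (SmoothFunctions n M) (Set.range q),
      toLocalization Q V₂ (LocalizedModule.mk r' 1) ∈
        Submodule.span ((smoothSheaf n M).obj.obj (op V₂)) (Set.range fun i ↦
          sheafRestrict (localization Q) ((h₂₁.trans hV₁).trans hV)
            (toLocalization Q U (LocalizedModule.mk (q i) 1))) := by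
    intro r' hr'
    induction hr' using Submodule.span_induction with
    | mem r' hr' =>
      obtain ⟨i, rfl⟩ := hr'
      refine Submodule.subset_span ⟨i, ?_⟩
      simp only
      rw [toLocalization_restrict]
      exact congrArg _ (liftOfLE_mk Q ((h₂₁.trans hV₁).trans hV) (q i) 1)
    | zero =>
      rw [LocalizedModule.zero_mk, map_zero]
      exact Submodule.zero_mem _
    | add a b _ _ ha hb =>
      have : (LocalizedModule.mk (a + b) 1 : LocalizedModule (nonvanishing n V₂) Q) =
          LocalizedModule.mk a 1 + LocalizedModule.mk b 1 := by
        rw [LocalizedModule.mk_add_mk]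
        simp
      rw [this, map_add]
      exact Submodule.add_mem _ ha hb
    | smul c a _ ha =>
      have : (LocalizedModule.mk (c • a) 1 : LocalizedModule (nonvanishing n V₂) Q) =
          (Localization.mk c 1 : Localization (nonvanishing n V₂)) • LocalizedModule.mk a 1 := by
        rw [LocalizedModule.mk_smul_mk, mul_one]
      rw [this, toLocalization_smul]
      exact Submodule.smul_mem _ _ ha
  change sheafRestrict (localization Q) (h₂₁.trans hV₁) t ∈
    Submodule.span ((smoothSheaf n M).obj.obj (op V₂)) (Set.range fun i ↦
      sheafRestrict (localization Q) ((h₂₁.trans hV₁).trans hV)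
        (toLocalization Q U (LocalizedModule.mk (q i) 1)))
  rw [← sheafRestrict_sheafRestrict _ hV₁ h₂₁, ← hy, toLocalization_restrict,
    show localizedRestrict Q h₂₁ (LocalizedModule.mk r d) = LocalizedModule.mk r d' from
      liftOfLE_mk Q h₂₁ r d]
  have e : (LocalizedModule.mk r d' : LocalizedModule (nonvanishing n V₂) Q) =
      Localization.mk 1 (f' * d') • LocalizedModule.mk (f • r) 1 := by
    rw [LocalizedModule.mk_smul_mk, LocalizedModule.mk_eq]
    refine ⟨1, ?_⟩
    simp only [Submonoid.smul_def, one_smul, mul_one, f', mul_smul]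
    rw [smul_comm]
  rw [e, toLocalization_smul]
  refine Submodule.smul_mem _ _ ?_
  exact hspan _ hf

theorem exists_generatesAt_of_isLocallyFinitelyGenerated (h : IsLocallyFinitelyGenerated Q)
    (m : M) : ∃ (W : Opens M) (k : ℕ) (q : Fin k → Q), m ∈ W ∧ ∀ x ∈ W, GeneratesAt q x := by
  obtain ⟨U, k, s, hmU, hs⟩ := h m
  have hs' : ∀ i, ∃ (V : Opens M) (hV : V ≤ U) (q : Q) (d : nonvanishing n V), m ∈ V ∧
      toLocalization Q V (LocalizedModule.mk q d) =
        sheafRestrict (localization Q) hV (s i) := fun i ↦ by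
    obtain ⟨V, hV, y, hmV, hy⟩ := toLocalization_locally_surjective Q (s i) hmU
    induction y using LocalizedModule.induction_on with | _ q d
    exact ⟨V, hV, q, d, hmV, hy⟩
  choose V hV q d hmV hq using hs'
  let W : Opens M := U ⊓ ⟨⋂ i, V i, isOpen_iInter_of_finite fun i ↦ (V i).isOpen⟩
  have hWU : W ≤ U := inf_le_left
  have hWV : ∀ i, W ≤ V i := fun i x hx ↦ Set.mem_iInter.1 hx.2 i
  refine ⟨W, k, q, ⟨hmU, Set.mem_iInter.2 hmV⟩, fun x hx r ↦ ?_⟩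
  obtain ⟨W', hW', hxW', hr⟩ := hs W hWU (toLocalization Q W (LocalizedModule.mk r 1)) x hx
  -- Near `x`, the elements of the span of the `s i` are fractions with numerator in the span of
  -- the `q i`.
  have key : ∀ t ∈ Submodule.span ((smoothSheaf n M).obj.obj (op W')) (Set.range fun i ↦
      sheafRestrict (localization Q) (hW'.trans hWU) (s i)),
      ∃ (N : Opens M) (hN : N ≤ W') (r' : Q) (d' : nonvanishing n N), x ∈ N ∧
        r' ∈ Submodule.span (SmoothFunctions n M) (Set.range q) ∧
        sheafRestrict (localization Q) hN t =
          toLocalization Q N (LocalizedModule.mk r' d') := by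
    intro t ht
    induction ht using Submodule.span_induction with
    | mem t ht =>
      obtain ⟨i, rfl⟩ := ht
      have hi : W' ≤ V i := hW'.trans (hWV i)
      refine ⟨W', le_rfl, q i, ⟨d i, nonvanishing_mono hi (d i).2⟩, hxW',
        Submodule.subset_span ⟨i, rfl⟩, ?_⟩
      simp only
      rw [sheafRestrict_sheafRestrict, ← sheafRestrict_sheafRestrict _ (hV i) hi, ← hq,
        toLocalization_restrict]
      exact congrArg _ (liftOfLE_mk Q hi (q i) (d i))
    | zero =>
      refine ⟨W', le_rfl, 0, 1, hxW', Submodule.zero_mem _, ?_⟩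
      rw [LocalizedModule.zero_mk, map_zero, map_zero]
    | add a b _ _ ha hb =>
      obtain ⟨N₁, hN₁, r₁, d₁, hx₁, hr₁, h₁⟩ := ha
      obtain ⟨N₂, hN₂, r₂, d₂, hx₂, hr₂, h₂⟩ := hb
      have l₁ : N₁ ⊓ N₂ ≤ N₁ := inf_le_left
      have l₂ : N₁ ⊓ N₂ ≤ N₂ := inf_le_right
      refine ⟨N₁ ⊓ N₂, l₁.trans hN₁, d₂.1 • r₁ + d₁.1 • r₂,
        ⟨d₁, nonvanishing_mono l₁ d₁.2⟩ * ⟨d₂, nonvanishing_mono l₂ d₂.2⟩, ⟨hx₁, hx₂⟩,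
        Submodule.add_mem _ (Submodule.smul_mem _ _ hr₁) (Submodule.smul_mem _ _ hr₂), ?_⟩
      have e₁ := toLocalization_restrict Q l₁ (LocalizedModule.mk r₁ d₁)
      have e₂ := toLocalization_restrict Q l₂ (LocalizedModule.mk r₂ d₂)
      rw [← h₁, sheafRestrict_sheafRestrict] at e₁
      rw [← h₂, sheafRestrict_sheafRestrict] at e₂
      rw [map_add, e₁, e₂, ← map_add]
      refine congrArg _ ?_
      refine (congrArg₂ (· + ·) (liftOfLE_mk Q l₁ r₁ d₁) (liftOfLE_mk Q l₂ r₂ d₂)).trans ?_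
      exact LocalizedModule.mk_add_mk
    | smul a t _ ht =>
      obtain ⟨N₁, hN₁, r₁, d₁, hx₁, hr₁, h₁⟩ := ht
      obtain ⟨N₂, hN₂, b, hx₂, hb⟩ := exists_fraction_eq a hxW'
      have l₁ : N₁ ⊓ N₂ ≤ N₁ := inf_le_left
      have l₂ : N₁ ⊓ N₂ ≤ N₂ := inf_le_right
      induction b using Localization.induction_on with | _ p
      refine ⟨N₁ ⊓ N₂, l₁.trans hN₁, p.1 • r₁,
        ⟨p.2, nonvanishing_mono l₂ p.2.2⟩ * ⟨d₁, nonvanishing_mono l₁ d₁.2⟩, ⟨hx₁, hx₂⟩,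
        Submodule.smul_mem _ _ hr₁, ?_⟩
      have e₁ := toLocalization_restrict Q l₁ (LocalizedModule.mk r₁ d₁)
      rw [← h₁, sheafRestrict_sheafRestrict] at e₁
      rw [sheafRestrict_smul, e₁]
      have e₂ : (smoothSheaf n M).obj.map (homOfLE (l₁.trans hN₁)).op a =
          fromLocalization (N₁ ⊓ N₂)
            (Localization.mk p.1 ⟨p.2, nonvanishing_mono l₂ p.2.2⟩) := by
        refine ContMDiffMap.ext fun y ↦ ?_
        have h' := congrArg (fun g : SmoothFunctions n N₂ ↦ g (Set.inclusion l₂ y)) hb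
        exact (h'.trans (fromLocalization_mk p.1 p.2 (Set.inclusion l₂ y))).trans
          (fromLocalization_mk p.1 ⟨p.2, nonvanishing_mono l₂ p.2.2⟩ y).symm
      have e₃ : localizedRestrict Q l₁ (LocalizedModule.mk r₁ d₁) =
          LocalizedModule.mk r₁ ⟨d₁.1, nonvanishing_mono l₁ d₁.2⟩ := liftOfLE_mk Q l₁ r₁ d₁
      rw [e₂, e₃, ← LocalizedModule.mk_smul_mk, toLocalization_smul]
  obtain ⟨N, hN, r', d', hxN, hr', he⟩ :=
    key (sheafRestrict (localization Q) hW' (toLocalization Q W (LocalizedModule.mk r 1))) hr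
  rw [sheafRestrict_sheafRestrict, toLocalization_restrict] at he
  obtain ⟨N', hN', hxN', he'⟩ := toLocalization_locally_injective Q he hxN
  have he'' : LocalizedModule.mk r (1 : nonvanishing n N') =
      LocalizedModule.mk r' ⟨d'.1, nonvanishing_mono hN' d'.2⟩ := by
    refine Eq.trans ?_ (he'.trans (liftOfLE_mk Q hN' r' d'))
    symm
    refine (congrArg (localizedRestrict Q hN') (liftOfLE_mk Q (hN.trans hW') r 1)).trans ?_
    exact liftOfLE_mk Q hN' r _
  obtain ⟨c, hc⟩ := LocalizedModule.mk_eq.1 he''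
  refine ⟨c.1 * d'.1, mul_ne_zero (c.2 x hxN') (d'.2 x hxN), ?_⟩
  simp only [Submonoid.smul_def, one_smul] at hc
  rw [mul_smul, hc]
  exact Submodule.smul_mem _ _ hr'

end LocalizedSections

/-! ### Modules of sections and their morphisms -/

section Cutoff

variable {n : ℕ} {M : Type u} [TopologicalSpace M] [ChartedSpace (EuclideanSpace ℝ (Fin n)) M]

/-- Extension by zero of the product of a function which is smooth on `U` with a cutoff function
supported in `U`. -/
theorem exists_cutoff_mul {U : Set M} (hU : IsOpen U) (χ : SmoothFunctions n M)
    (hχ : tsupport χ ⊆ U) {h : M → ℝ} (hh : ContMDiffOn (𝓡 n) 𝓘(ℝ, ℝ) ∞ h U) :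
    ∃ f : SmoothFunctions n M, ∀ y, f y = χ y * h y := by
  refine ⟨⟨fun y ↦ χ y * h y, contMDiff_of_tsupport fun y hy ↦ ?_⟩, fun y ↦ rfl⟩
  have hyU : y ∈ U := hχ (tsupport_mul_subset_left hy)
  exact (χ.contMDiff y).mul (hh.contMDiffAt (hU.mem_nhds hyU))

end Cutoff

namespace VBTepui

variable {n : ℕ} {M : Type u} [TopologicalSpace M] [ChartedSpace (EuclideanSpace ℝ (Fin n)) M]

section

variable {E : VBTepui n M}

/-- Evaluation of sections at a point. -/
def Section.eval (m : M) : E.Section →+ E.Fiber m where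
  toFun s := s.toFun m
  map_zero' := rfl
  map_add' _ _ := rfl

theorem Section.eval_smul (m : M) (f : SmoothFunctions n M) (s : E.Section) :
    Section.eval m (f • s) = f m • Section.eval m s := rfl

theorem Section.eval_sum_smul (m : M) {d : ℕ} (f : Fin d → SmoothFunctions n M)
    (s : Fin d → E.Section) :
    Section.eval m (∑ i, f i • s i) = ∑ i, f i m • (s i).toFun m :=
  map_sum _ _ _

theorem Section.eval_eq_zero_of_mem {m : M} {s : E.Section}
    (hs : s ∈ (vanishingIdeal (n := n) m • ⊤ : Submodule (SmoothFunctions n M) E.Section)) :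
    Section.eval m s = 0 := by
  refine Submodule.smul_induction_on hs (fun f hf t _ ↦ ?_) fun t r ht hr ↦ ?_
  · have hf' : f m = 0 := hf
    rw [Section.eval_smul, hf', zero_smul]
  · rw [map_add, ht, hr, add_zero]

end

theorem isFiberDetermined_section (E : VBTepui n M) :
    IsFiberDetermined ((sectionFunctor n M).obj E) := fun _ hs ↦
  Section.ext <| funext fun m ↦
    Section.eval_eq_zero_of_mem ((Submodule.Quotient.mk_eq_zero _).1 (hs m))

variable [IsManifold (𝓡 n) ∞ M] [T2Space M]

/-- The sections of a local frame generate all sections locally, over the ring of smooth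
functions. -/
theorem exists_local_frame_section (E : VBTepui n M) (m : M) :
    ∃ (W : Opens M) (d : ℕ) (s : Fin d → E.Section), m ∈ W ∧
      LinearIndependent ℝ (fun i ↦ (s i).toFun m) ∧
      (∀ {k : ℕ} {a : 𝔼 k → E.Total} {y : 𝔼 k}, IsPlot a → (a y).1 ∈ W →
        ∃ g : 𝔼 k → Fin d → ℝ, ContDiff ℝ ∞ g ∧ ∀ᶠ z in 𝓝 y, a z = comb s (a z).1 (g z)) ∧
      ∀ x ∈ W, ∀ r : E.Section, ∃ (χ : SmoothFunctions n M) (f : Fin d → SmoothFunctions n M),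
        χ x = 1 ∧ χ • r = ∑ i, f i • s i := by
  obtain ⟨W, d, s, hW, hmW, hli, hfr⟩ := exists_local_frame E m
  refine ⟨⟨W, hW⟩, d, s, hmW, hli, hfr, fun x hx r ↦ ?_⟩
  obtain ⟨β, γ, hβ, hβ0, hβo, hγ, hγβ⟩ := exists_parametrization (n := n) x
  obtain ⟨g, hg, hge⟩ := hfr (y := 0) (isPlot_section r hβ) (by rw [hβ0]; exact hx)
  obtain ⟨O, hO, hOo, h0O⟩ := eventually_nhds_iff.1 hge
  let U : Set M := Set.range β ∩ γ ⁻¹' O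
  have hU : IsOpen U := hγ.continuousOn.isOpen_inter_preimage hβo hOo
  have hxU : x ∈ U := ⟨⟨0, hβ0⟩, by rw [← hβ0, Set.mem_preimage, hγβ]; exact h0O⟩
  obtain ⟨χ, hχ1, hχU⟩ := exists_cutoff (n := n) hU hxU
  have hgγ : ∀ i, ContMDiffOn (𝓡 n) 𝓘(ℝ, ℝ) ∞ (fun y ↦ g (γ y) i) U := fun i ↦
    (contDiff_pi.1 hg i).contMDiff.comp_contMDiffOn (hγ.mono Set.inter_subset_left)
  choose f hf using fun i ↦ exists_cutoff_mul hU χ hχU (hgγ i)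
  refine ⟨χ, f, hχ1.self_of_nhds, Section.ext (funext fun y ↦ ?_)⟩
  change χ y • r.toFun y = Section.eval y (∑ i, f i • s i)
  rw [Section.eval_sum_smul]
  simp only [hf, mul_smul, ← Finset.smul_sum]
  by_cases hy : y ∈ U
  · obtain ⟨⟨z, rfl⟩, hz⟩ := hy
    rw [Set.mem_preimage, hγβ] at hz
    rw [hγβ]
    exact congrArg _ (eq_of_heq (Sigma.mk.inj (hO z hz)).2)
  · rw [image_eq_zero_of_notMem_tsupport fun h ↦ hy (hχU h), zero_smul, zero_smul]

theorem isLocallyFinitelyGenerated_section (E : VBTepui n M) :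
    IsLocallyFinitelyGenerated ((sectionFunctor n M).obj E) := by
  refine isLocallyFinitelyGenerated_of_generatesAt _ fun m ↦ ?_
  obtain ⟨W, d, s, hmW, -, -, hs⟩ := exists_local_frame_section E m
  refine ⟨W, d, s, hmW, fun x hx r ↦ ?_⟩
  obtain ⟨χ, f, hχ, hr⟩ := hs x hx r
  refine ⟨χ, by rw [hχ]; exact one_ne_zero, ?_⟩
  have hr' : χ • r = ∑ i, f i • s i := hr
  rw [hr']
  exact Submodule.sum_mem _ fun i _ ↦ Submodule.smul_mem _ _ (Submodule.subset_span ⟨i, rfl⟩)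

variable {E E' : VBTepui n M}

/-- A linear map between modules of sections is local: the value of the image at a point depends on
the value at this point only. -/
theorem eval_map_eq_zero (α : E.Section →ₗ[SmoothFunctions n M] E'.Section) {m : M}
    {r : E.Section} (hr : r.toFun m = 0) : (α r).toFun m = 0 := by
  obtain ⟨W, d, s, hmW, hli, -, hs⟩ := exists_local_frame_section E m
  obtain ⟨χ, f, hχ, hf⟩ := hs m hmW r
  have h0 : ∑ i, f i m • (s i).toFun m = 0 := by
    rw [← Section.eval_sum_smul, ← hf, Section.eval_smul]
    change χ m • r.toFun m = 0
    rw [hr, smul_zero]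
  have hf0 := Fintype.linearIndependent_iff.1 hli _ h0
  have h1 := congrArg (Section.eval m) (congrArg α hf)
  rw [map_smul, Section.eval_smul, hχ, one_smul, map_sum] at h1
  simp only [map_smul] at h1
  refine h1.trans ((Section.eval_sum_smul m f _).trans ?_)
  simp [hf0]

theorem eval_map_congr (α : E.Section →ₗ[SmoothFunctions n M] E'.Section) {m : M}
    {r r' : E.Section} (h : r.toFun m = r'.toFun m) : (α r).toFun m = (α r').toFun m := by
  have h0 : (α (r - r')).toFun m = 0 := by
    refine eval_map_eq_zero α ?_
    change Section.eval m (r - r') = 0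
    rw [map_sub, sub_eq_zero]
    exact h
  rw [map_sub] at h0
  change Section.eval m (α r - α r') = 0 at h0
  rw [map_sub, sub_eq_zero] at h0
  exact h0

/-- The morphism of VB-tepui which induces a given linear map between the modules of sections. -/
def homOfSectionMap (α : E.Section →ₗ[SmoothFunctions n M] E'.Section) : E.Hom E' where
  toFun m :=
    { toFun := fun v ↦ (α (exists_section_eq m v).choose).toFun m
      map_add' := fun v w ↦ by
        rw [eval_map_congr α (r' := (exists_section_eq m v).choose +
          (exists_section_eq m w).choose), map_add]
        · rfl
        · rw [(exists_section_eq m (v + w)).choose_spec]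
          change _ = (exists_section_eq m v).choose.toFun m +
            (exists_section_eq m w).choose.toFun m
          rw [(exists_section_eq m v).choose_spec, (exists_section_eq m w).choose_spec]
      map_smul' := fun c v ↦ by
        rw [eval_map_congr α (r' := algebraMap ℝ (SmoothFunctions n M) c •
          (exists_section_eq m v).choose), map_smul]
        · rfl
        · rw [(exists_section_eq m (c • v)).choose_spec]
          change _ = c • (exists_section_eq m v).choose.toFun m
          rw [(exists_section_eq m v).choose_spec] }
  dSmooth k a ha := isPlot_of_eventuallyEq fun y ↦ by
    obtain ⟨W, d, s, hmW, -, hW, -⟩ := exists_local_frame_section E (a y).1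
    obtain ⟨g, hg, hge⟩ := hW ha hmW
    refine ⟨fun z ↦ comb (fun i ↦ α (s i)) (a z).1 (g z), isPlot_comb _ (contMDiff_proj ha) hg, ?_⟩
    filter_upwards [hge] with z hz
    refine Sigma.ext rfl (heq_of_eq ?_)
    have h2 : (a z).2 = ∑ i, g z i • (s i).toFun (a z).1 := eq_of_heq (Sigma.mk.inj hz).2
    have h3 := eval_map_congr α (m := (a z).1)
      (r' := ∑ i, algebraMap ℝ (SmoothFunctions n M) (g z i) • s i)
      ((exists_section_eq (a z).1 (a z).2).choose_spec.trans
        (h2.trans (Section.eval_sum_smul (a z).1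
          (fun i ↦ algebraMap ℝ (SmoothFunctions n M) (g z i)) s).symm))
    refine h3.trans ?_
    rw [map_sum]
    simp only [map_smul]
    exact Section.eval_sum_smul (a z).1 (fun i ↦ algebraMap ℝ (SmoothFunctions n M) (g z i)) _

theorem mapSection_homOfSectionMap (α : E.Section →ₗ[SmoothFunctions n M] E'.Section) :
    (homOfSectionMap α).mapSection = α :=
  LinearMap.ext fun s ↦ Section.ext <| funext fun m ↦
    eval_map_congr α (exists_section_eq m (s.toFun m)).choose_spec

instance : (sectionFunctor n M).Full where
  map_surjective α := ⟨homOfSectionMap α.hom,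
    ModuleCat.hom_ext (mapSection_homOfSectionMap α.hom)⟩

instance : (sectionFunctor n M).Faithful where
  map_injective {E E'} f g h := by
    refine Hom.ext (funext fun m ↦ LinearMap.ext fun v ↦ ?_)
    obtain ⟨s, rfl⟩ := exists_section_eq (E := E) m v
    exact congrFun (congrArg Section.toFun
      (LinearMap.congr_fun (congrArg ModuleCat.Hom.hom h) s)) m

end VBTepui

/-! ### The sheaf of sections -/

namespace VBTepui

variable {n : ℕ} {M : Type u} [TopologicalSpace M] [ChartedSpace (EuclideanSpace ℝ (Fin n)) M]
  (E : VBTepui n M)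

/-- The local predicate `smooth` on sections of a VB-tepui over open subsets of the base. -/
def sectionPredicate : TopCat.LocalPredicate (X := TopCat.of M) fun x ↦ E.Fiber x where
  pred {U} f := ∀ (k : ℕ) (p : 𝔼 k → M) (hU : ∀ y, p y ∈ U), ContMDiff (𝓡 k) (𝓡 n) ∞ p →
    IsPlot fun y ↦ (⟨p y, f ⟨p y, hU y⟩⟩ : E.Total)
  res {U V} i f hf k p hU hp := hf k p (fun y ↦ leOfHom i (hU y)) hp
  locality {V} f h k p hV hp := isPlot_of_eventuallyEq fun y ↦ by
    obtain ⟨U, hyU, i, hU⟩ := h ⟨p y, hV y⟩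
    obtain ⟨ρ, hρ, hρU, hρe⟩ := exists_contDiff_retract (U.isOpen.preimage hp.continuous) hyU
    refine ⟨_, hU k (p ∘ ρ) hρU (hp.comp hρ.contMDiff), ?_⟩
    filter_upwards [hρe] with z hz
    have : ∀ (x : M) (hx : x ∈ V) (x' : M) (hx' : x' ∈ V), x = x' →
        (⟨x, f ⟨x, hx⟩⟩ : E.Total) = ⟨x', f ⟨x', hx'⟩⟩ := by
      rintro x hx _ hx' rfl
      rfl
    exact this _ _ _ _ (congrArg p hz.symm)

/-- The additive group of smooth sections over an open subset of the base. -/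
def localSections (U : Opens M) : AddSubgroup (∀ x : U, E.Fiber x) where
  carrier := {f | E.sectionPredicate.pred (U := (U : Opens (TopCat.of M))) f}
  add_mem' hf hg k p hU hp := isPlot_add (hf k p hU hp) (hg k p hU hp)
  zero_mem' _ _ _ hp := isPlot_zero hp
  neg_mem' {f} hf k p hU hp := by
    have h := isPlot_smul (c := fun _ ↦ -1) contDiff_const (hf k p hU hp)
    simpa using h

instance (U : Opens M) : Module (SmoothFunctions n U) (E.localSections U) where
  smul a f := ⟨fun x ↦ a x • f.1 x, fun k p hU hp ↦ isPlot_smul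
    (a.contMDiff.comp ((ContMDiff.subtypeVal_comp_iff U fun y ↦ ⟨p y, hU y⟩).1 hp)).contDiff
      (f.2 k p hU hp)⟩
  one_smul f := Subtype.ext (funext fun x ↦ one_smul ℝ (f.1 x))
  mul_smul a b f := Subtype.ext (funext fun x ↦ mul_smul (a x) (b x) (f.1 x))
  smul_zero a := Subtype.ext (funext fun x ↦ smul_zero (a x))
  smul_add a f g := Subtype.ext (funext fun x ↦ smul_add (a x) (f.1 x) (g.1 x))
  add_smul a b f := Subtype.ext (funext fun x ↦ add_smul (a x) (b x) (f.1 x))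
  zero_smul f := Subtype.ext (funext fun x ↦ zero_smul ℝ (f.1 x))

/-- The restriction of sections to a smaller open subset. -/
def restrictSections {U V : Opens M} (h : V ≤ U) : E.localSections U →ₛₗ[
    (ContMDiffMap.restrictRingHom (𝓡 n) 𝓘(ℝ, ℝ) ℝ h : SmoothFunctions n U →+* SmoothFunctions n V)]
      E.localSections V where
  toFun f := ⟨fun x ↦ f.1 ⟨x, h x.2⟩, fun k p hU hp ↦ f.2 k p (fun y ↦ h (hU y)) hp⟩
  map_add' _ _ := rfl
  map_smul' _ _ := rfl

/-- The presheaf of smooth sections. -/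
def sectionPresheaf : PresheafOfModules.{u} (smoothSheaf n M).obj where
  obj U := ModuleCat.of (SmoothFunctions n (unop U : Opens M)) (E.localSections (unop U))
  map {_ V} i := ModuleCat.semilinearMapAddEquiv ((smoothSheaf n M).obj.map i).hom _
    (ModuleCat.of (SmoothFunctions n (unop V : Opens M)) _)
      (E.restrictSections (leOfHom i.unop))
  map_id _ := rfl
  map_comp _ _ := rfl

/-- The sheaf of smooth sections. -/
def sectionSheaf : SheafOfModules.{u} (smoothSheaf n M) where
  val := E.sectionPresheaf
  isSheaf := by
    rw [Presheaf.isSheaf_iff_isSheaf_forget _ _ (forget Ab)]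
    exact TopCat.subpresheafToTypes.isSheaf E.sectionPredicate

/-- A global section of the sheaf of sections is a smooth section. -/
def globalSectionsEquiv : (globalSections n M).obj E.sectionSheaf ≃ₗ[SmoothFunctions n M]
    (sectionFunctor n M).obj E where
  toFun f := (⟨fun m ↦ Subtype.val (p := (· ∈ E.localSections ⊤)) f ⟨m, trivial⟩,
    fun k p hp ↦ Subtype.property (p := (· ∈ E.localSections ⊤)) f k p (fun _ ↦ trivial) hp⟩ :
      E.Section)
  invFun s := (⟨fun x ↦ Section.toFun s x, fun k p _ hp ↦ Section.dSmooth s k p hp⟩ :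
    E.localSections ⊤)
  left_inv _ := rfl
  right_inv _ := rfl
  map_add' _ _ := rfl
  map_smul' _ _ := rfl

theorem isGlobal_section : IsGlobal ((sectionFunctor n M).obj E) :=
  ⟨E.sectionSheaf, ⟨E.globalSectionsEquiv.toModuleIso⟩⟩

end VBTepui

/-! ### Fibres of modules -/

section FiberModule

variable {n : ℕ} {M : Type u} [TopologicalSpace M] [ChartedSpace (EuclideanSpace ℝ (Fin n)) M]
  (Q : ModuleCat.{u} (SmoothFunctions n M))

/-- The fibre `Q / I_m Q` of a `C^∞(M)`-module at a point `m`. -/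
def FiberAt (m : M) : Type u :=
  Q ⧸ (vanishingIdeal (n := n) m • ⊤ : Submodule (SmoothFunctions n M) Q)

instance (m : M) : AddCommGroup (FiberAt Q m) :=
  inferInstanceAs (AddCommGroup
    (Q ⧸ (vanishingIdeal (n := n) m • ⊤ : Submodule (SmoothFunctions n M) Q)))

/-- The fibres are real vector spaces, with real numbers acting as constant functions. -/
instance (m : M) : Module ℝ (FiberAt Q m) :=
  letI : Module (SmoothFunctions n M) (FiberAt Q m) := inferInstanceAs (Module _
    (Q ⧸ (vanishingIdeal (n := n) m • ⊤ : Submodule (SmoothFunctions n M) Q)))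
  Module.compHom _ (algebraMap ℝ (SmoothFunctions n M))

variable {Q}

/-- The value of an element of a module at a point. -/
def fiberMk (m : M) : Q →+ FiberAt Q m :=
  (Submodule.mkQ (vanishingIdeal (n := n) m • ⊤ : Submodule (SmoothFunctions n M) Q)).toAddMonoidHom

theorem fiberMk_eq_zero {m : M} {q : Q} : fiberMk m q = 0 ↔
    q ∈ (vanishingIdeal (n := n) m • ⊤ : Submodule (SmoothFunctions n M) Q) :=
  Submodule.Quotient.mk_eq_zero _

theorem fiberMk_surjective (m : M) : Function.Surjective (fiberMk (Q := Q) m) :=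
  Submodule.mkQ_surjective _

theorem fiberMk_const_smul (m : M) (c : ℝ) (q : Q) :
    fiberMk m (algebraMap ℝ (SmoothFunctions n M) c • q) = c • fiberMk m q := rfl

theorem mem_vanishingIdeal {m : M} {f : SmoothFunctions n M} :
    f ∈ vanishingIdeal (n := n) m ↔ f m = 0 := Iff.rfl

theorem fiberMk_smul (m : M) (f : SmoothFunctions n M) (q : Q) :
    fiberMk m (f • q) = f m • fiberMk m q := by
  rw [← fiberMk_const_smul, ← sub_eq_zero, ← map_sub, ← sub_smul, fiberMk_eq_zero]
  refine Submodule.smul_mem_smul ?_ Submodule.mem_top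
  rw [mem_vanishingIdeal]
  exact sub_self (f m)

theorem fiberMk_sum_smul (m : M) {ι : Type*} [Fintype ι] (f : ι → SmoothFunctions n M) (q : ι → Q) :
    fiberMk m (∑ i, f i • q i) = ∑ i, f i m • fiberMk m (q i) := by
  rw [map_sum]
  exact Finset.sum_congr rfl fun i _ ↦ fiberMk_smul m (f i) (q i)

theorem mem_span_range_iff {d : ℕ} {q : Fin d → Q} {r : Q} :
    r ∈ Submodule.span (SmoothFunctions n M) (Set.range q) ↔
      ∃ f : Fin d → SmoothFunctions n M, ∑ i, f i • q i = r :=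
  Submodule.mem_span_range_iff_exists_fun _

/-- If `q` generates the stalk of `Q` at `m`, then the multiples by `I_m` of the elements of `Q`
are, in the stalk, combinations of the `q i` with coefficients in `I_m`. -/
theorem GeneratesAt.exists_smul_mem_smul_span {d : ℕ} {q : Fin d → Q} {m : M}
    (hq : GeneratesAt q m) {t : Q}
    (ht : t ∈ (vanishingIdeal (n := n) m • ⊤ : Submodule (SmoothFunctions n M) Q)) :
    ∃ f : SmoothFunctions n M, f m ≠ 0 ∧
      f • t ∈ vanishingIdeal (n := n) m • Submodule.span (SmoothFunctions n M) (Set.range q) := by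
  refine Submodule.smul_induction_on ht (fun a ha r _ ↦ ?_) fun x y hx hy ↦ ?_
  · obtain ⟨f, hf, hr⟩ := hq r
    refine ⟨f, hf, ?_⟩
    rw [smul_comm]
    exact Submodule.smul_mem_smul ha hr
  · obtain ⟨f, hf, hfx⟩ := hx
    obtain ⟨g, hg, hgy⟩ := hy
    refine ⟨f * g, mul_ne_zero hf hg, ?_⟩
    rw [smul_add]
    refine Submodule.add_mem _ ?_ ?_
    · rw [mul_comm, mul_smul]
      exact Submodule.smul_mem _ _ hfx
    · rw [mul_smul]
      exact Submodule.smul_mem _ _ hgy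

theorem GeneratesAt.exists_sum_eq {d : ℕ} {q : Fin d → Q} {m : M} (hq : GeneratesAt q m)
    (v : FiberAt Q m) : ∃ c : Fin d → ℝ, ∑ i, c i • fiberMk m (q i) = v := by
  obtain ⟨r, rfl⟩ := fiberMk_surjective m v
  obtain ⟨f, hf, hr⟩ := hq r
  obtain ⟨g, hg⟩ := mem_span_range_iff.1 hr
  refine ⟨fun i ↦ (f m)⁻¹ * g i m, ?_⟩
  simp only [mul_smul, ← Finset.smul_sum]
  rw [← fiberMk_sum_smul, hg, fiberMk_smul, inv_smul_smul₀ hf]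

/-- A linear relation between the values at `m` of generators of the stalk extends to a relation
with smooth coefficients. -/
theorem GeneratesAt.exists_relation {d : ℕ} {q : Fin d → Q} {m : M} (hq : GeneratesAt q m)
    {c : Fin d → ℝ} (hc : ∑ i, c i • fiberMk m (q i) = 0) :
    ∃ h : Fin d → SmoothFunctions n M, (∀ i, h i m = c i) ∧ ∑ i, h i • q i = 0 := by
  let t : Q := ∑ i, algebraMap ℝ (SmoothFunctions n M) (c i) • q i
  have ht : fiberMk m t = 0 := (fiberMk_sum_smul m _ _).trans hc
  obtain ⟨f, hf, hft⟩ := hq.exists_smul_mem_smul_span (fiberMk_eq_zero.1 ht)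
  obtain ⟨a, ha, hat⟩ := (Submodule.mem_ideal_smul_span_iff_exists_sum _ _ _).1 hft
  rw [Finsupp.sum_fintype _ (fun i c ↦ c • q i) fun i ↦ zero_smul _ _] at hat
  let e := algebraMap ℝ (SmoothFunctions n M) (f m)⁻¹
  refine ⟨fun i ↦ e * (f * algebraMap ℝ (SmoothFunctions n M) (c i) - a i), fun i ↦ ?_, ?_⟩
  · have h1 : a i m = 0 := ha i
    change (f m)⁻¹ * (f m * c i - a i m) = c i
    rw [h1, sub_zero, inv_mul_cancel_left₀ hf]
  · simp only [mul_smul, sub_smul, ← Finset.smul_sum, Finset.sum_sub_distrib]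
    rw [hat]
    change e • (f • t - f • t) = 0
    rw [sub_self, smul_zero]

variable [IsManifold (𝓡 n) ∞ M] [T2Space M]

/-- Near each point `m`, a locally finitely generated module is generated by elements whose values
at `m` form a basis of the fibre, by Nakayama's lemma. -/
theorem exists_module_frame (hQ : IsLocallyFinitelyGenerated Q) (m : M) :
    ∃ (W : Opens M) (d : ℕ) (q : Fin d → Q), m ∈ W ∧
      LinearIndependent ℝ (fun i ↦ fiberMk m (q i)) ∧ ∀ x ∈ W, GeneratesAt q x := by
  obtain ⟨W, k, r, hmW, hr⟩ := exists_generatesAt_of_isLocallyFinitelyGenerated Q hQ m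
  obtain ⟨κ, b, hb, hspan, hli⟩ := exists_linearIndependent' ℝ fun i ↦ fiberMk m (r i)
  have : Fintype κ := Fintype.ofInjective b hb
  let e := Fintype.equivFin κ
  let q : Fin (Fintype.card κ) → Q := fun i ↦ r (b (e.symm i))
  have hqli : LinearIndependent ℝ fun i ↦ fiberMk m (q i) := hli.comp _ e.symm.injective
  let N := Submodule.span (SmoothFunctions n M) (Set.range q)
  let P := Submodule.span (SmoothFunctions n M) (Set.range r)
  have hP : P ≤ N ⊔ vanishingIdeal (n := n) m • P := by
    refine Submodule.span_le.2 ?_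
    rintro _ ⟨j, rfl⟩
    have h1 : fiberMk m (r j) ∈ Submodule.span ℝ (Set.range fun i ↦ fiberMk m (q i)) := by
      have h2 : (Set.range fun i ↦ fiberMk m (q i)) =
          Set.range ((fun i ↦ fiberMk m (r i)) ∘ b) :=
        e.symm.surjective.range_comp fun i ↦ fiberMk m (r (b i))
      rw [h2, hspan]
      exact Submodule.subset_span ⟨j, rfl⟩
    obtain ⟨c, hc⟩ := (Submodule.mem_span_range_iff_exists_fun ℝ).1 h1
    let t : Q := ∑ i, algebraMap ℝ (SmoothFunctions n M) (c i) • q i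
    have htN : t ∈ N := mem_span_range_iff.2 ⟨_, rfl⟩
    have ht : fiberMk m (r j - t) = 0 := by
      rw [map_sub, sub_eq_zero]
      exact hc.symm.trans
        (fiberMk_sum_smul m (fun i ↦ algebraMap ℝ (SmoothFunctions n M) (c i)) q).symm
    obtain ⟨f, hf, hft⟩ := (hr m hmW).exists_smul_mem_smul_span (fiberMk_eq_zero.1 ht)
    -- Up to the unit `f m`, the difference `r j - t` itself belongs to `N + I_m P`.
    let a := algebraMap ℝ (SmoothFunctions n M) (f m)
    have ha : algebraMap ℝ (SmoothFunctions n M) (f m)⁻¹ * a = 1 := by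
      rw [← map_mul, inv_mul_cancel₀ hf, map_one]
    have hfa : f - a ∈ vanishingIdeal (n := n) m := mem_vanishingIdeal.2 (sub_self (f m))
    have hrt : r j - t ∈ P := Submodule.sub_mem _ (Submodule.subset_span ⟨j, rfl⟩)
      (Submodule.span_mono (by rintro _ ⟨i, rfl⟩; exact ⟨_, rfl⟩) htN)
    have hmem : a • (r j - t) ∈ vanishingIdeal (n := n) m • P := by
      have : a • (r j - t) = f • (r j - t) - (f - a) • (r j - t) := by
        rw [sub_smul, sub_sub_cancel]
      rw [this]
      exact Submodule.sub_mem _ hft (Submodule.smul_mem_smul hfa hrt)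
    have hmem' : r j - t ∈ vanishingIdeal (n := n) m • P := by
      have := Submodule.smul_mem _ (algebraMap ℝ (SmoothFunctions n M) (f m)⁻¹) hmem
      rwa [← mul_smul, ha, one_smul] at this
    have := Submodule.add_mem_sup htN hmem'
    rwa [add_sub_cancel] at this
  obtain ⟨f, hf, hfP⟩ := Submodule.exists_sub_one_mem_and_smul_le_of_fg_of_le_sup
    (Submodule.fg_span (Set.finite_range r)) le_rfl hP
  have hfm : f m = 1 := sub_eq_zero.1 (mem_vanishingIdeal.1 hf)
  refine ⟨W ⊓ ⟨{y | f y ≠ 0}, isOpen_ne.preimage f.contMDiff.continuous⟩, _, q,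
    ⟨hmW, by change f m ≠ 0; rw [hfm]; exact one_ne_zero⟩, hqli, fun x hx t ↦ ?_⟩
  obtain ⟨g, hg, hgt⟩ := hr x hx.1 t
  refine ⟨f * g, mul_ne_zero hx.2 hg, ?_⟩
  rw [mul_smul]
  exact hfP (Submodule.smul_mem_pointwise_smul _ _ _ hgt)

end FiberModule

/-! ### The VB-tepui of fibres of a module -/

section DTopology

variable {X Y : Type*} [DiffeologicalSpace X] [DiffeologicalSpace Y]

theorem IsPlotwiseSubmersion.isOpenMap {φ : X → Y} (hφ : IsPlotwiseSubmersion φ) :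
    @IsOpenMap X Y dTopology dTopology φ := by
  intro V hV
  rw [isOpen_iff_preimages_plots] at hV ⊢
  intro k a ha
  rw [isOpen_iff_mem_nhds]
  rintro y ⟨x, hx, hxy⟩
  obtain ⟨q, hq, hqy, hqe⟩ := hφ.exists_lift_family ha.smoothFamily hxy.symm
  have hmem : q ⁻¹' V ∈ 𝓝 y := (hV k q hq.isPlot).mem_nhds (by rwa [Set.mem_preimage, hqy])
  filter_upwards [hmem, hqe] with z h1 h2
  exact ⟨q z, h1, h2⟩

/-- A space which is covered by countably many plots that are plotwise submersions is
second-countable. -/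
theorem secondCountable_of_charts {ι : Type*} [Countable ι] {k : ι → ℕ} (P : ∀ i, 𝔼 (k i) → X)
    (hP : ∀ i, IsPlotwiseSubmersion (P i)) (hsurj : ∀ x, ∃ i, x ∈ Set.range (P i)) :
    @SecondCountableTopology X dTopology := by
  let _ : TopologicalSpace X := dTopology
  let F : (Σ i, 𝔼 (k i)) → X := fun z ↦ P z.1 z.2
  have hc : Continuous F := continuous_sigma fun i ↦ (hP i).dSmooth.continuous
  have ho : IsOpenMap F := isOpenMap_sigma.2 fun i ↦ (hP i).isOpenMap
  have hs : Function.Surjective F := fun x ↦ by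
    obtain ⟨i, y, hy⟩ := hsurj x
    exact ⟨⟨i, y⟩, hy⟩
  exact (ho.isQuotientMap hc hs).secondCountableTopology ho

/-- A diffeological space which is diffeomorphic to a Euclidean space is Hausdorff and
second-countable. -/
theorem t2Space_and_secondCountable_of_diffeomorphic {d : ℕ} {f : X → 𝔼 d} {g : 𝔼 d → X}
    (hf : DSmooth f) (hg : DSmooth g) (hgf : ∀ x, g (f x) = x) (hfg : ∀ y, f (g y) = y) :
    @T2Space X dTopology ∧ @SecondCountableTopology X dTopology := by
  let _ : TopologicalSpace X := dTopology
  let e : X ≃ₜ 𝔼 d := ⟨⟨f, g, hgf, hfg⟩, hf.continuous, hg.continuous⟩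
  exact ⟨e.symm.t2Space, e.secondCountableTopology⟩

end DTopology

section FiberBundle

variable {n : ℕ} {M : Type u} [TopologicalSpace M] [ChartedSpace (EuclideanSpace ℝ (Fin n)) M]
  {Q : ModuleCat.{u} (SmoothFunctions n M)}

/-- The linear combination of the values at `x` of finitely many elements of a module. -/
def combAt {ι : Type*} [Fintype ι] (q : ι → Q) (x : M) (c : ι → ℝ) : Σ m, FiberAt Q m :=
  ⟨x, ∑ i, c i • fiberMk x (q i)⟩

theorem eq_combAt_iff {ι : Type*} [Fintype ι] {q : ι → Q} {e : Σ m, FiberAt Q m} {c : ι → ℝ} :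
    e = combAt q e.1 c ↔ e.2 = ∑ i, c i • fiberMk e.1 (q i) :=
  ⟨fun h ↦ eq_of_heq (Sigma.ext_iff.1 h).2, fun h ↦ Sigma.ext rfl (heq_of_eq h)⟩

/-- The plots of the union of the fibres of a module: the base component is smooth, and locally the
plot is a linear combination of elements of the module with smooth coefficients. -/
def IsFiberPlot {k : ℕ} (a : 𝔼 k → Σ m, FiberAt Q m) : Prop :=
  ContMDiff (𝓡 k) (𝓡 n) ∞ (fun y ↦ (a y).1) ∧ ∀ y, ∃ (ι : Type) (_ : Fintype ι) (q : ι → Q)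
    (g : 𝔼 k → ι → ℝ), ContDiff ℝ ∞ g ∧ ∀ᶠ z in 𝓝 y, a z = combAt q (a z).1 (g z)

theorem isFiberPlot_combAt {ι : Type} [Fintype ι] (q : ι → Q) {k : ℕ} {b : 𝔼 k → M}
    (hb : ContMDiff (𝓡 k) (𝓡 n) ∞ b) {g : 𝔼 k → ι → ℝ} (hg : ContDiff ℝ ∞ g) :
    IsFiberPlot fun y ↦ combAt q (b y) (g y) :=
  ⟨hb, fun _ ↦ ⟨ι, _, q, g, hg, Filter.Eventually.of_forall fun _ ↦ rfl⟩⟩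

theorem combAt_unit (r : Q) (x : M) : combAt (fun _ : Unit ↦ r) x 1 = ⟨x, fiberMk x r⟩ := by
  simp [combAt]

theorem isFiberPlot_fiberMk (r : Q) {k : ℕ} {b : 𝔼 k → M} (hb : ContMDiff (𝓡 k) (𝓡 n) ∞ b) :
    IsFiberPlot fun y ↦ (⟨b y, fiberMk (b y) r⟩ : Σ m, FiberAt Q m) := by
  simp only [← combAt_unit]
  exact isFiberPlot_combAt _ hb contDiff_const

variable (Q) in
/-- The diffeology on the union of the fibres whose plots are locally combinations, with smooth
coefficients, of elements of the module. -/
instance fiberDiffeology : DiffeologicalSpace (Σ m, FiberAt Q m) where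
  plots k := {a | IsFiberPlot a}
  constant_plots {k} e := by
    obtain ⟨r, hr⟩ := fiberMk_surjective e.1 e.2
    have h := isFiberPlot_fiberMk r (b := fun _ : 𝔼 k ↦ e.1) contMDiff_const
    rw [hr] at h
    exact h
  plot_reparam {k l a f} ha hf := by
    refine ⟨ha.1.comp hf.contMDiff, fun y ↦ ?_⟩
    obtain ⟨ι, _, q, g, hg, hge⟩ := ha.2 (f y)
    exact ⟨ι, _, q, g ∘ f, hg.comp hf, (hf.continuous.tendsto y).eventually hge⟩
  locality {k a} ha := by
    have key : ∀ y, ∃ a' : 𝔼 k → Σ m, FiberAt Q m, IsFiberPlot a' ∧ ∀ᶠ z in 𝓝 y, a z = a' z :=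
      fun y ↦ by
        obtain ⟨u, hu, hyu, h⟩ := ha y
        obtain ⟨ρ, hρ, hρu, hρe⟩ := exists_contDiff_retract hu hyu
        refine ⟨a ∘ ρ, h hρu hρ, ?_⟩
        filter_upwards [hρe] with z hz
        simp [hz]
    refine ⟨fun y ↦ ?_, fun y ↦ ?_⟩
    · obtain ⟨a', ha', hae⟩ := key y
      exact (ha'.1 y).congr_of_eventuallyEq (hae.mono fun z hz ↦ congrArg Sigma.fst hz)
    · obtain ⟨a', ha', hae⟩ := key y
      obtain ⟨ι, _, q, g, hg, hge⟩ := ha'.2 y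
      refine ⟨ι, _, q, g, hg, ?_⟩
      filter_upwards [hae, hge] with z h1 h2
      rw [h1]
      exact h2

variable (Q) in
/-- The union of the fibres of a module, as a diffeological bundle of vector spaces. -/
def fiberBundle : DiffVectorBundle n M where
  Fiber := FiberAt Q
  diffeology := fiberDiffeology Q
  dSmooth_proj _ _ ha := ha.1
  dSmooth_zero k b hb := by
    have h := isFiberPlot_fiberMk (0 : Q) (show ContMDiff (𝓡 k) (𝓡 n) ∞ b from hb)
    simp only [map_zero] at h
    exact h
  dSmooth_add k a ha := by
    obtain ⟨ha₁, ha₂⟩ := ha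
    refine ⟨ha₁.1, fun y ↦ ?_⟩
    obtain ⟨ι, _, q, g, hg, hge⟩ := ha₁.2 y
    obtain ⟨ι', _, q', g', hg', hge'⟩ := ha₂.2 y
    refine ⟨ι ⊕ ι', inferInstance, Sum.elim q q', fun z ↦ Sum.elim (g z) (g' z),
      contDiff_pi.2 ?_, ?_⟩
    · rintro (i | i)
      · exact contDiff_pi.1 hg i
      · exact contDiff_pi.1 hg' i
    · filter_upwards [hge, hge'] with z h1 h2
      rw [eq_combAt_iff] at h1 h2 ⊢
      rw [Fintype.sum_sum_type]
      exact congrArg₂ (· + ·) h1 h2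
  dSmooth_smul k a ha := by
    obtain ⟨ha₁, ha₂⟩ := ha
    refine ⟨ha₂.1, fun y ↦ ?_⟩
    obtain ⟨ι, _, q, g, hg, hge⟩ := ha₂.2 y
    refine ⟨ι, _, q, fun z i ↦ (a z).1 * g z i,
      contDiff_pi.2 fun i ↦ ha₁.contDiff.mul (contDiff_pi.1 hg i), ?_⟩
    filter_upwards [hge] with z h1
    rw [eq_combAt_iff] at h1 ⊢
    simp only [mul_smul, ← Finset.smul_sum]
    exact congrArg _ h1

/-- If the `q i` generate the stalk at the base point of `a y`, then the plot `a` is a smooth linear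
combination of the `q i` near `y`, with arbitrarily prescribed admissible coefficients at `y`. -/
theorem exists_coefficients_of_generatesAt {d : ℕ} {q : Fin d → Q} {k : ℕ}
    {a : 𝔼 k → Σ m, FiberAt Q m} (ha : IsFiberPlot a) {y : 𝔼 k} (hq : GeneratesAt q (a y).1)
    {c : Fin d → ℝ} (hc : a y = combAt q (a y).1 c) :
    ∃ g : 𝔼 k → Fin d → ℝ, ContDiff ℝ ∞ g ∧ g y = c ∧
      ∀ᶠ z in 𝓝 y, a z = combAt q (a z).1 (g z) := by
  obtain ⟨hb, h⟩ := ha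
  obtain ⟨ι, _, r, g, hg, hge⟩ := h y
  choose s hs hsr using fun j ↦ hq (r j)
  choose f hf using fun j ↦ mem_span_range_iff.1 (hsr j)
  let N : Set (𝔼 k) := ⋂ j, {z | s j (a z).1 ≠ 0}
  have hN : IsOpen N := isOpen_iInter_of_finite fun j ↦
    isOpen_ne.preimage ((s j).contMDiff.continuous.comp hb.continuous)
  obtain ⟨ρ, hρ, hρN, hρe⟩ := exists_contDiff_retract hN (Set.mem_iInter.2 hs : y ∈ N)
  have hsm : ∀ f : SmoothFunctions n M, ContDiff ℝ ∞ fun z ↦ f (a z).1 := fun f ↦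
    (f.contMDiff.comp hb).contDiff
  let G : 𝔼 k → Fin d → ℝ := fun z i ↦
    ∑ j, g z j * ((s j (a (ρ z)).1)⁻¹ * f j i (a (ρ z)).1)
  have hG : ContDiff ℝ ∞ G := contDiff_pi.2 fun i ↦ ContDiff.sum fun j _ ↦
    (contDiff_pi.1 hg j).mul ((((hsm (s j)).comp hρ).inv fun z ↦
      Set.mem_iInter.1 (hρN z) j).mul ((hsm (f j i)).comp hρ))
  have hGe : ∀ᶠ z in 𝓝 y, a z = combAt q (a z).1 (G z) := by
    filter_upwards [hge, hρe] with z h1 h2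
    rw [eq_combAt_iff] at h1 ⊢
    rw [h1]
    have h3 : ∀ j, fiberMk (a z).1 (r j) =
        ∑ i, ((s j (a z).1)⁻¹ * f j i (a z).1) • fiberMk (a z).1 (q i) := fun j ↦ by
      have h4 : s j (a z).1 ≠ 0 := h2 ▸ Set.mem_iInter.1 (hρN z) j
      simp only [mul_smul, ← Finset.smul_sum]
      rw [← fiberMk_sum_smul, hf, fiberMk_smul, inv_smul_smul₀ h4]
    simp only [G, h2, Finset.sum_smul, h3, Finset.smul_sum, smul_smul]
    rw [Finset.sum_comm]
  -- The coefficients at `y` are adjusted by a relation between the `q i`.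
  have hrel : ∑ i, (c i - G y i) • fiberMk (a y).1 (q i) = 0 := by
    simp only [sub_smul, Finset.sum_sub_distrib]
    rw [← eq_combAt_iff.1 hc, ← eq_combAt_iff.1 hGe.self_of_nhds, sub_self]
  obtain ⟨e, he, her⟩ := hq.exists_relation hrel
  refine ⟨fun z i ↦ G z i + e i (a z).1,
    contDiff_pi.2 fun i ↦ (contDiff_pi.1 hG i).add (hsm (e i)), ?_, ?_⟩
  · funext i
    change G y i + e i (a y).1 = c i
    rw [he, add_sub_cancel]
  · filter_upwards [hGe] with z hz
    rw [eq_combAt_iff] at hz ⊢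
    simp only [add_smul, Finset.sum_add_distrib]
    rw [← hz, ← fiberMk_sum_smul, her, map_zero, add_zero]

variable [IsManifold (𝓡 n) ∞ M] [T2Space M]

/-- The linear combinations of a module frame at `m`, over a parametrization of the base, are a
minimal chart at all points of the fibre over `m`. -/
theorem exists_fiber_chart (hQ : IsLocallyFinitelyGenerated Q) (m : M) :
    ∃ (k : ℕ) (P : 𝔼 k → Σ m, FiberAt Q m) (N : Set M), IsPlotwiseSubmersion P ∧ IsOpen N ∧
      m ∈ N ∧ Set.range P = {e | e.1 ∈ N} ∧ Set.InjOn P {w | (P w).1 = m} := by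
  obtain ⟨W, d, q, hmW, hli, hq⟩ := exists_module_frame hQ m
  obtain ⟨β, γ, hβW, hβ, hβ0, hβo, hγ, hγβ⟩ := exists_parametrization_subset (n := n) W.isOpen hmW
  let T : 𝔼 (n + d) ≃L[ℝ] 𝔼 n × (Fin d → ℝ) := ContinuousLinearEquiv.ofFinrankEq (by simp)
  let P : 𝔼 (n + d) → Σ m, FiberAt Q m := fun w ↦ combAt q (β (T w).1) (T w).2
  have hP : IsPlot P := isFiberPlot_combAt q (hβ.comp (contDiff_fst.comp T.contDiff).contMDiff)
    (contDiff_snd.comp T.contDiff)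
  refine ⟨n + d, P, Set.range β, ⟨hP.dSmooth, fun w k a ha haw ↦ ?_⟩, hβo, ⟨0, hβ0⟩, ?_, ?_⟩
  · have ha1 : (a 0).1 = β (T w).1 := congrArg Sigma.fst haw
    obtain ⟨g, hg, hg0, hge⟩ := exists_coefficients_of_generatesAt ha (c := (T w).2)
      (by rw [ha1]; exact hq _ (hβW ⟨_, rfl⟩)) (by rw [ha1]; exact haw)
    have hb : ContMDiff (𝓡 k) (𝓡 n) ∞ fun y ↦ (a y).1 := ha.1
    obtain ⟨ρ, hρ, hρN, hρe⟩ := exists_contDiff_retract (hβo.preimage hb.continuous)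
      (show (0 : 𝔼 k) ∈ (fun y ↦ (a y).1) ⁻¹' Set.range β from ⟨_, ha1.symm⟩)
    refine ⟨fun z ↦ T.symm (γ (a (ρ z)).1, g z), (T.symm.contDiff.comp
      ((hγ.comp_contMDiff (hb.comp hρ.contMDiff) hρN).contDiff.prodMk hg)).isPlot, ?_, ?_⟩
    · simp only [hρe.self_of_nhds, ha1, hγβ, hg0, Prod.mk.eta]
      exact T.symm_apply_apply w
    · filter_upwards [hge, hρe] with z h1 h2
      have h3 : β (γ (a z).1) = (a z).1 := by
        obtain ⟨x, hx⟩ := hρN z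
        simp only [h2] at hx
        rw [← hx, hγβ]
      simp only [Function.comp, P, T.apply_symm_apply, h2, h3]
      exact h1.symm
  · ext e
    constructor
    · rintro ⟨w, rfl⟩
      exact ⟨_, rfl⟩
    · rintro ⟨x, hx⟩
      obtain ⟨c, hc⟩ := (hq e.1 (hx ▸ hβW ⟨x, rfl⟩)).exists_sum_eq e.2
      refine ⟨T.symm (x, c), ?_⟩
      simp only [P, T.apply_symm_apply, hx]
      exact (eq_combAt_iff.2 hc.symm).symm
  · intro w hw w' hw' h
    have h1 : β (T w).1 = m := hw
    have h1' : β (T w').1 = m := hw'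
    have h2 : (T w).1 = (T w').1 := by rw [← hγβ (T w).1, h1, ← h1', hγβ]
    have h3 : combAt q m (T w).2 = combAt q m (T w').2 := by
      have : combAt q (β (T w).1) (T w).2 = combAt q (β (T w').1) (T w').2 := h
      rwa [h1, h1'] at this
    have h4 : (T w).2 = (T w').2 :=
      linearIndependent_iff_injective_fintypeLinearCombination.1 hli (eq_of_heq (Sigma.mk.inj h3).2)
    exact T.injective (Prod.ext h2 h4)

/-- The fibres over points of the base are diffeomorphic to Euclidean spaces. -/
theorem t2Space_and_secondCountable_fiber (hQ : IsLocallyFinitelyGenerated Q) (m : M) :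
    @T2Space {x : Σ m, FiberAt Q m // x.1 = m} dTopology ∧
      @SecondCountableTopology {x : Σ m, FiberAt Q m // x.1 = m} dTopology := by
  obtain ⟨W, d, q, hmW, hli, hq⟩ := exists_module_frame hQ m
  have huniq : ∀ c c' : Fin d → ℝ, combAt q m c = combAt q m c' → c = c' := fun c c' h ↦
    linearIndependent_iff_injective_fintypeLinearCombination.1 hli (eq_of_heq (Sigma.mk.inj h).2)
  have hex : ∀ x : {x : Σ m, FiberAt Q m // x.1 = m}, ∃ c : Fin d → ℝ, x.1 = combAt q m c := by
    rintro ⟨x, rfl⟩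
    obtain ⟨c, hc⟩ := (hq _ hmW).exists_sum_eq x.2
    exact ⟨c, eq_combAt_iff.2 hc.symm⟩
  choose κ hκ using hex
  let e : 𝔼 d ≃L[ℝ] (Fin d → ℝ) := EuclideanSpace.equiv (Fin d) ℝ
  refine t2Space_and_secondCountable_of_diffeomorphic (d := d) (f := fun x ↦ e.symm (κ x))
    (g := fun c ↦ ⟨combAt q m (e c), rfl⟩) ?_ ?_ ?_ ?_
  · intro k a ha
    refine isPlot_of_eventuallyEq fun y ↦ ?_
    have ha' : IsFiberPlot fun z ↦ (a z).1 := ha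
    obtain ⟨g, hg, -, hge⟩ := exists_coefficients_of_generatesAt ha' (y := y) (c := κ (a y))
      (by rw [(a y).2]; exact hq m hmW) (by rw [(a y).2]; exact hκ _)
    refine ⟨fun z ↦ e.symm (g z), (e.symm.contDiff.comp hg).isPlot, ?_⟩
    filter_upwards [hge] with z hz
    refine congrArg e.symm (huniq _ _ ?_)
    rw [← hκ, hz, (a z).2]
  · intro k c hc
    exact isFiberPlot_combAt q contMDiff_const (e.contDiff.comp hc.contDiff)
  · intro x
    refine Subtype.ext ?_
    simp only [e.apply_symm_apply]
    exact (hκ x).symm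
  · intro c
    exact (congrArg e.symm (huniq _ _ (hκ _).symm)).trans (e.symm_apply_apply c)

variable [SecondCountableTopology M]

/-- The VB-tepui of fibres of a locally finitely generated module. -/
def fiberTepui (hQ : IsLocallyFinitelyGenerated Q) : VBTepui n M where
  toDiffVectorBundle := fiberBundle Q
  isTepuiFibration := by
    let _ := manifoldDiffeology n M
    refine ⟨⟨⟨(fiberBundle Q).dSmooth_proj, ?_⟩, fun m ↦ ⟨⟨m, 0⟩, rfl⟩⟩, ?_, ?_,
      fun m ↦ (t2Space_and_secondCountable_fiber hQ m).1,
      fun m ↦ (t2Space_and_secondCountable_fiber hQ m).2⟩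
    · rintro ⟨m, v⟩ k p hp hpm
      obtain ⟨r, rfl⟩ := fiberMk_surjective m v
      refine ⟨fun y ↦ ⟨p y, fiberMk (p y) r⟩, isFiberPlot_fiberMk r hp, ?_,
        Filter.Eventually.of_forall fun _ ↦ rfl⟩
      have hpm' : p 0 = m := hpm
      change (⟨p 0, fiberMk (p 0) r⟩ : Σ m, FiberAt Q m) = ⟨m, fiberMk m r⟩
      rw [hpm']
    · choose k P N hP hN hmN hrange _ using exists_fiber_chart hQ
      obtain ⟨T, hT, hTN⟩ := TopologicalSpace.isOpen_iUnion_countable N hN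
      have : Countable T := hT.to_subtype
      refine secondCountable_of_charts (fun i : T ↦ P i) (fun i ↦ hP i) fun e ↦ ?_
      have he : e.1 ∈ ⋃ i ∈ T, N i := hTN ▸ Set.mem_iUnion.2 ⟨e.1, hmN e.1⟩
      simp only [Set.mem_iUnion] at he
      obtain ⟨i, hi, hei⟩ := he
      refine ⟨⟨i, hi⟩, ?_⟩
      exact (hrange i).ge hei
    · intro e
      obtain ⟨k, P, N, hP, -, hmN, hrange, hinj⟩ := exists_fiber_chart hQ e.1
      refine ⟨k, Set.univ, fun w ↦ P w.1, isOpen_univ, ⟨fun l c hc ↦ hP.dSmooth l _ hc, ?_⟩, ?_,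
        fun w hw w' hw' h ↦ Subtype.ext (hinj hw hw' h)⟩
      · intro w l a ha haw
        obtain ⟨c, hc, hc0, hce⟩ := hP.exists_lift w.1 l a ha haw
        exact ⟨fun y ↦ ⟨c y, trivial⟩, hc, Subtype.ext hc0, hce⟩
      · obtain ⟨w, hw⟩ := hrange.ge hmN
        exact ⟨⟨w, trivial⟩, hw⟩

end FiberBundle

/-! ### Modules as modules of sections -/

section Gluing

variable {n : ℕ} {M : Type u} [TopologicalSpace M] [ChartedSpace (EuclideanSpace ℝ (Fin n)) M]
  (S : SheafOfModules.{u} (smoothSheaf n M))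

theorem eq_zero_of_locally_eq_zero {V : Opens M} (t : S.val.obj (op V))
    (h : ∀ x ∈ V, ∃ (N : Opens M) (hN : N ≤ V), x ∈ N ∧ sheafRestrict S hN t = 0) : t = 0 := by
  choose N hN hxN ht using fun x : V ↦ h x x.2
  refine TopCat.Sheaf.eq_of_locally_eq' (X := TopCat.of M) ⟨S.val.presheaf, S.isSheaf⟩ N V
    (fun x ↦ homOfLE (hN x)) (fun x hx ↦ Opens.mem_iSup.2 ⟨⟨x, hx⟩, hxN _⟩) t 0 fun x ↦ ?_
  exact (ht x).trans (map_zero (sheafRestrict S (hN x))).symm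

theorem exists_sheafRestrict_eq (N : M → Opens M) (hN : ∀ x, x ∈ N x)
    (t : ∀ x, S.val.obj (op (N x)))
    (ht : ∀ x y, sheafRestrict S (inf_le_left : N x ⊓ N y ≤ N x) (t x) =
      sheafRestrict S (inf_le_right : N x ⊓ N y ≤ N y) (t y)) :
    ∃ s : S.val.obj (op ⊤), ∀ x, sheafRestrict S le_top s = t x := by
  let F : TopCat.Sheaf Ab (TopCat.of M) := ⟨S.val.presheaf, S.isSheaf⟩
  let t' : ∀ x, ToType (F.1.obj (op (N x))) := t
  exact (F.existsUnique_gluing' N ⊤ (fun _ ↦ homOfLE le_top)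
    (fun x _ ↦ Opens.mem_iSup.2 ⟨x, hN x⟩) t' ht).exists

variable {S} {Q : ModuleCat.{u} (SmoothFunctions n M)}
  (e : (globalSections n M).obj S ≃ₗ[SmoothFunctions n M] Q)

/-- The restriction to an open subset of an element of a module of global sections. -/
def restrictGlobal (U : Opens M) : Q →+ S.val.obj (op U) :=
  (sheafRestrict S (le_top : U ≤ ⊤)).comp
    (show Q →+ S.val.obj (op ⊤) from (e.symm : Q →+ (globalSections n M).obj S))

theorem restrictGlobal_smul (U : Opens M) (f : SmoothFunctions n M) (q : Q) :
    restrictGlobal e U (f • q) =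
      (show (smoothSheaf n M).obj.obj (op U) from restrict U f) • restrictGlobal e U q := by
  have h : e.symm (f • q) = f • e.symm q := map_smul _ _ _
  exact (congrArg (sheafRestrict S (le_top : U ≤ ⊤)) h).trans
    (sheafRestrict_smul S le_top (restrict ⊤ f) (e.symm q))

theorem sheafRestrict_restrictGlobal {U V : Opens M} (h : V ≤ U) (q : Q) :
    sheafRestrict S h (restrictGlobal e U q) = restrictGlobal e V q :=
  sheafRestrict_sheafRestrict S le_top h _

theorem restrictGlobal_smul_eq_zero {U : Opens M} {f : SmoothFunctions n M}
    (hf : ∀ y ∈ U, f y = 0) (q : Q) : restrictGlobal e U (f • q) = 0 := by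
  have h : restrict U f = 0 := ContMDiffMap.ext fun y ↦ hf y y.2
  rw [restrictGlobal_smul, h]
  exact zero_smul ((smoothSheaf n M).obj.obj (op U)) _

theorem eq_zero_of_restrictGlobal_eq_zero {q : Q}
    (h : ∀ x, ∃ N : Opens M, x ∈ N ∧ restrictGlobal e N q = 0) : q = 0 := by
  have h0 : (show S.val.obj (op ⊤) from e.symm q) = 0 :=
    eq_zero_of_locally_eq_zero S _ fun x _ ↦ by
      obtain ⟨N, hx, hN⟩ := h x
      exact ⟨N, le_top, hx, hN⟩
  exact e.symm.map_eq_zero_iff.1 h0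

variable [IsManifold (𝓡 n) ∞ M] [T2Space M]

/-- An element of a fibre-determined module of global sections whose values vanish on an open
subset restricts to zero there. -/
theorem restrictGlobal_eq_zero_of_fiberMk (hQ : IsFiberDetermined Q) {W : Opens M} {q : Q}
    (hq : ∀ x ∈ W, fiberMk x q = 0) : restrictGlobal e W q = 0 := by
  refine eq_zero_of_locally_eq_zero S _ fun x hx ↦ ?_
  obtain ⟨χ, hχ, hχW⟩ := exists_cutoff (n := n) W.isOpen hx
  have h0 : χ • q = 0 := hQ _ fun y ↦ by
    change fiberMk y (χ • q) = 0
    rw [fiberMk_smul]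
    by_cases hy : y ∈ W
    · rw [hq y hy, smul_zero]
    · rw [image_eq_zero_of_notMem_tsupport fun h ↦ hy (hχW h), zero_smul]
  obtain ⟨N, hN, hNo, hxN⟩ := eventually_nhds_iff.1 hχ
  let N' : Opens M := W ⊓ ⟨N, hNo⟩
  refine ⟨N', inf_le_left, ⟨hx, hxN⟩, ?_⟩
  rw [sheafRestrict_restrictGlobal]
  have h1 : restrictGlobal e N' ((χ - 1) • q) = 0 :=
    restrictGlobal_smul_eq_zero e (fun y (hy : y ∈ N') ↦ sub_eq_zero.2 (hN y hy.2)) q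
  rwa [sub_smul, h0, one_smul, zero_sub, map_neg, neg_eq_zero] at h1

theorem fiberMk_eq_zero_of_restrictGlobal {W : Opens M} {q : Q} (hq : restrictGlobal e W q = 0)
    {x : M} (hx : x ∈ W) : fiberMk x q = 0 := by
  obtain ⟨χ, hχ, hχW⟩ := exists_cutoff (n := n) W.isOpen hx
  have h0 : χ • q = 0 := eq_zero_of_restrictGlobal_eq_zero e fun y ↦ by
    by_cases hy : y ∈ tsupport χ
    · refine ⟨W, hχW hy, ?_⟩
      rw [restrictGlobal_smul, hq]
      exact smul_zero _
    · exact ⟨⟨(tsupport χ)ᶜ, (isClosed_tsupport χ).isOpen_compl⟩, hy,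
        restrictGlobal_smul_eq_zero e (fun z hz ↦ image_eq_zero_of_notMem_tsupport hz) q⟩
  have h1 := congrArg (fiberMk x) h0
  rwa [fiberMk_smul, hχ.self_of_nhds, one_smul, map_zero] at h1

end Gluing

section Reconstruction

variable {n : ℕ} {M : Type u} [TopologicalSpace M] [ChartedSpace (EuclideanSpace ℝ (Fin n)) M]
  [IsManifold (𝓡 n) ∞ M] [T2Space M] [SecondCountableTopology M]
  {Q : ModuleCat.{u} (SmoothFunctions n M)}

/-- An element of a module as a section of the VB-tepui of fibres. -/
def fiberSection (hQ : IsLocallyFinitelyGenerated Q) :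
    Q →ₗ[SmoothFunctions n M] (fiberTepui hQ).Section where
  toFun q := ⟨fun m ↦ fiberMk m q, fun _ _ hp ↦ isFiberPlot_fiberMk q hp⟩
  map_add' q r := VBTepui.Section.ext (funext fun m ↦ map_add (fiberMk m) q r)
  map_smul' f q := VBTepui.Section.ext (funext fun m ↦ fiberMk_smul m f q)

/-- A section of the VB-tepui of fibres is locally given by an element of the module. -/
theorem exists_fiberSection_eventuallyEq (hQ : IsLocallyFinitelyGenerated Q)
    (s : (fiberTepui hQ).Section) (m : M) : ∃ q : Q, ∀ᶠ y in 𝓝 m, fiberMk y q = s.toFun y := by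
  obtain ⟨W, d, q, hmW, -, hq⟩ := exists_module_frame hQ m
  obtain ⟨β, γ, hβ, hβ0, hβo, hγ, hγβ⟩ := exists_parametrization (n := n) m
  let a : 𝔼 n → Σ m, FiberAt Q m := fun z ↦ ⟨β z, s.toFun (β z)⟩
  have hgen : GeneratesAt q (a 0).1 := by
    change GeneratesAt q (β 0)
    rw [hβ0]
    exact hq m hmW
  obtain ⟨c, hc⟩ := hgen.exists_sum_eq (a 0).2
  obtain ⟨g, hg, -, hge⟩ := exists_coefficients_of_generatesAt (show IsFiberPlot a from
    s.dSmooth n β hβ) hgen (eq_combAt_iff.2 hc.symm)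
  obtain ⟨O, hO, hOo, h0O⟩ := eventually_nhds_iff.1 hge
  let U : Set M := Set.range β ∩ γ ⁻¹' O
  have hU : IsOpen U := hγ.continuousOn.isOpen_inter_preimage hβo hOo
  have hmU : m ∈ U := ⟨⟨0, hβ0⟩, by rw [← hβ0, Set.mem_preimage, hγβ]; exact h0O⟩
  obtain ⟨χ, hχ1, hχU⟩ := exists_cutoff (n := n) hU hmU
  have hgγ : ∀ i, ContMDiffOn (𝓡 n) 𝓘(ℝ, ℝ) ∞ (fun y ↦ g (γ y) i) U := fun i ↦
    (contDiff_pi.1 hg i).contMDiff.comp_contMDiffOn (hγ.mono Set.inter_subset_left)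
  choose f hf using fun i ↦ exists_cutoff_mul hU χ hχU (hgγ i)
  refine ⟨∑ i, f i • q i, ?_⟩
  filter_upwards [hχ1, hU.mem_nhds hmU] with y hy hyU
  obtain ⟨⟨z, rfl⟩, hz⟩ := hyU
  rw [Set.mem_preimage, hγβ] at hz
  rw [fiberMk_sum_smul]
  simp only [hf, hy, one_mul, hγβ]
  exact (eq_combAt_iff.1 (hO z hz)).symm

theorem fiberSection_injective (hQ : IsLocallyFinitelyGenerated Q) (hQ' : IsFiberDetermined Q) :
    Function.Injective (fiberSection hQ) :=
  (injective_iff_map_eq_zero _).2 fun q hq ↦ hQ' q fun m ↦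
    congrFun (congrArg VBTepui.Section.toFun hq) m

/-- The elements of a global, fibre-determined module which represent a section locally agree, as
sections of the sheaf, on overlaps; their gluing represents the section globally. -/
theorem fiberSection_surjective (hQ : IsLocallyFinitelyGenerated Q) (hg : IsGlobal Q)
    (hQ' : IsFiberDetermined Q) : Function.Surjective (fiberSection hQ) := by
  intro s
  obtain ⟨S, ⟨i⟩⟩ := hg
  let e := i.toLinearEquiv
  have hloc : ∀ m, ∃ (N : Opens M) (q : Q), m ∈ N ∧ ∀ y ∈ N, fiberMk y q = s.toFun y := fun m ↦ by
    obtain ⟨q, hq⟩ := exists_fiberSection_eventuallyEq hQ s m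
    obtain ⟨N, hN, hNo, hmN⟩ := eventually_nhds_iff.1 hq
    exact ⟨⟨N, hNo⟩, q, hmN, hN⟩
  choose N q hmN hN using hloc
  obtain ⟨t, ht⟩ := exists_sheafRestrict_eq S N hmN (fun m ↦ restrictGlobal e (N m) (q m))
    fun x y ↦ by
      rw [sheafRestrict_restrictGlobal, sheafRestrict_restrictGlobal, ← sub_eq_zero, ← map_sub]
      refine restrictGlobal_eq_zero_of_fiberMk e hQ' fun z hz ↦ ?_
      rw [map_sub, sub_eq_zero]
      exact (hN x z hz.1).trans (hN y z hz.2).symm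
  let r : Q := e t
  refine ⟨r, VBTepui.Section.ext (funext fun m ↦ ?_)⟩
  change fiberMk m r = s.toFun m
  have h1 : restrictGlobal e (N m) r = restrictGlobal e (N m) (q m) :=
    (congrArg (sheafRestrict S le_top) (e.symm_apply_apply t)).trans (ht m)
  have h2 := fiberMk_eq_zero_of_restrictGlobal e (q := r - q m)
    (by rw [map_sub, h1, sub_self]) (hmN m)
  rw [map_sub, sub_eq_zero] at h2
  rw [h2, hN m m (hmN m)]

/-- A locally finitely generated, global and fibre-determined module is the module of sections of
the VB-tepui of its fibres. -/
def sectionFiberTepuiIso (hQ : IsSerreSwanModule n M Q) :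
    (sectionFunctor n M).obj (fiberTepui hQ.1) ≅ Q :=
  (LinearEquiv.ofBijective (fiberSection hQ.1) ⟨fiberSection_injective hQ.1 hQ.2.2,
    fiberSection_surjective hQ.1 hQ.2.1 hQ.2.2⟩).toModuleIso.symm

end Reconstruction

end SerreSwan

end

open SerreSwan
theorem theorem2p7 (n : ℕ) (M : Type u) [TopologicalSpace M]
    [ChartedSpace (EuclideanSpace ℝ (Fin n)) M] [IsManifold (𝓡 n) ∞ M] [T2Space M]
    [SecondCountableTopology M] :
    ∃ h : ∀ E : VBTepui n M, IsSerreSwanModule n M ((sectionFunctor n M).obj E),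
      ((IsSerreSwanModule n M).lift (sectionFunctor n M) h).IsEquivalence := by
  let h : ∀ E : VBTepui n M, IsSerreSwanModule n M ((sectionFunctor n M).obj E) := fun E ↦
    ⟨E.isLocallyFinitelyGenerated_section, E.isGlobal_section, E.isFiberDetermined_section⟩
  have : ((IsSerreSwanModule n M).lift (sectionFunctor n M) h).EssSurj :=
    ⟨fun Q ↦ ⟨fiberTepui Q.property.1, ⟨ObjectProperty.isoMk _ (sectionFiberTepuiIso Q.property)⟩⟩⟩
  exact ⟨h, { }⟩
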